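/- Let $(X_t,(\mathbb P_x)_{x\in E})$ be a conservative continuous-time Markov process (jointly measurable in time and randomness) on a Polish space $E$, with semigroup $P_tf(x)=\mathbb E_x[f(X_t)]$ and an invariant probability measure $\mu$; write $\mathbb P_\mu=\int\mathbb P_x\,\mu(dx)$ and $[t]$ for the integer part of $t$. Say that $\mu$ satisfies the decay property with a non-increasing function $\eta:[0,\infty)\to\mathbb R$ if $$\mathrm{Var}_\mu(P_tf)\le \eta(t)\,\Big\|f-\int f\,d\mu\Big\|_\infty^2\qquad\text{for all bounded measurable } f \text{ and all } t\ge 0 .$$ The associated rate is $\alpha(r)=\sqrt{\eta(r)}$; if $(P_t)$ is symmetric with respect to $\mu$, one may also take $\alpha(r)=\eta(r/2)$. For every $c>0$ there exists a constant $k_0>0$, depending only on $c$, such that the following holds. Let $0<p\le 1$ and $c'>0$, and suppose that the decay property holds with some $\eta$ whose associated rate is $\alpha(s)=c\,e^{-c's^{p/(2-p)}}$, $s\ge0$. Then for every measurable $V:E\to\mathbb R$ with $\sup|V|=1$, every $0<R\le1$ and every $t>0$ with $t(1-R)<[t]$, $$\mathbb P_\mu\left(\frac1t\int_0^tV(X_s)\,ds-\int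 V\,d\mu\ \ge\ R\right)\ \le\ \exp\left\{-c(p)\left(\Big(R-\Big(1-\frac{[t]}t\Big)\Big)\sqrt t\right)^p\right\},$$ where $$c(p)=\frac{2-p}{p}\left(\frac12\right)^p\left(\frac{p\,c'}{2-p}\right)^{(2-p)/2},$$ provided that $$\Big(R-\Big(1-\frac{[t]}t\Big)\Big)\sqrt t\ \ge\ 2\,k_0^{1/p}\left(\frac{2-p}{p\,c'}\right)^{(2-p)/(2p)} .$$ -/

import Mathlib

open MeasureTheory ProbabilityTheory
open scoped NNReal ENNReal

/-- A conservative continuous-time (time-homogeneous) Markov process with state space `E`: a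
measurable family `(ℙ_x)` of probability measures on `Ω` and a jointly measurable process
`(X_t)_{t ≥ 0}` with values in `E`. Conservativeness is built in: the process lives in `E` at all
times and each `ℙ_x` has mass one. -/
structure MarkovProcess (E Ω : Type*) [MeasurableSpace E] [MeasurableSpace Ω] where
  /-- `Pr x` is the law `ℙ_x` of the process started at `x`. -/
  Pr : Kernel E Ω
  isMarkovKernel : IsMarkovKernel Pr
  /-- The process. -/
  X : ℝ≥0 → Ω → E
  /-- Joint measurability in time and randomness, so that `∫₀ᵗ V(X_s) ds` makes sense. -/
  measurable_X : Measurable (Function.uncurry X)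
  start : ∀ x, ∀ᵐ ω ∂(Pr x), X 0 ω = x
  /-- The Markov property: conditionally on `σ(X_u, u ≤ s)`, the probability under `ℙ_x` that
  `X_{s+t} ∈ B` is `ℙ_{X_s}(X_t ∈ B)`. -/
  markov : ∀ (x : E) (s t : ℝ≥0) (A : Set Ω),
    MeasurableSet[⨆ u : Set.Iic s, MeasurableSpace.comap (X u) inferInstance] A →
    ∀ B : Set E, MeasurableSet B →
      Pr x (A ∩ X (s + t) ⁻¹' B) = ∫⁻ ω in A, Pr (X s ω) (X t ⁻¹' B) ∂(Pr x)

namespace MarkovProcess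

variable {E Ω : Type*} [MeasurableSpace E] [MeasurableSpace Ω]

/-- The transition kernel `P_t(x, B) = ℙ_x(X_t ∈ B)`. -/
noncomputable def transition (M : MarkovProcess E Ω) (t : ℝ≥0) : Kernel E E :=
  M.Pr.map (M.X t)

/-- The semigroup acting on functions: `(P_t f)(x) = 𝔼_x[f(X_t)]`. -/
noncomputable def semigroup (M : MarkovProcess E Ω) (t : ℝ≥0) (f : E → ℝ) (x : E) : ℝ :=
  ∫ y, f y ∂(M.transition t x)

/-- The law `ℙ_μ = ∫ ℙ_x μ(dx)` of the process with initial law `μ`. -/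
noncomputable def law (M : MarkovProcess E Ω) (μ : Measure E) : Measure Ω :=
  μ.bind M.Pr

/-- `μ` is invariant for `(P_t)`. -/
def IsInvariant (M : MarkovProcess E Ω) (μ : Measure E) : Prop :=
  ∀ t, Kernel.Invariant (M.transition t) μ

/-- `(P_t)` is symmetric with respect to `μ`. -/
def IsSymmetric (M : MarkovProcess E Ω) (μ : Measure E) : Prop :=
  ∀ t, Kernel.IsReversible (M.transition t) μ

/-- The decay property: `η` is non-increasing on `[0, ∞)` and
`Var_μ(P_t f) ≤ η(t) ‖f - ∫ f dμ‖_∞²` for all bounded (measurable) `f` and all `t ≥ 0`. -/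
def Decay (M : MarkovProcess E Ω) (μ : Measure E) (η : ℝ≥0 → ℝ) : Prop :=
  Antitone η ∧
    ∀ f : E → ℝ, Measurable f → (∃ C, ∀ x, |f x| ≤ C) → ∀ t : ℝ≥0,
      Var[M.semigroup t f; μ] ≤ η t * (⨆ x, |f x - ∫ y, f y ∂μ|) ^ 2

/-- The decay property holds for some `η` with associated mixing rate `α`: `α(r) = √η(r)` in
general, and `α(r) = η(r / 2)` is also allowed when `μ` is symmetric. -/
def DecayWithRate (M : MarkovProcess E Ω) (μ : Measure E) (α : ℝ≥0 → ℝ) : Prop :=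
  ∃ η : ℝ≥0 → ℝ, M.Decay μ η ∧
    ((∀ r, α r = √(η r)) ∨ (M.IsSymmetric μ ∧ ∀ r, α r = η (r / 2)))

end MarkovProcess

/-!
Cut `[0, t]` into `2N` blocks of length `l`. Blocks of the same parity are separated by gaps of
length `l`, and by the Markov property the covariance between the past of time `u` and the future
of time `u + l` is controlled by `L¹`-mixing. Testing `P_l f` against its sign and applying
Cauchy–Schwarz turns the decay property into such mixing with error `4 α(l)`; in the symmetric case
one first splits `P_l = P_{l/2} P_{l/2}` by self-adjointness, whence the rate `η(l/2)`.

So the averages of `V - ∫ V dμ` over the blocks of one parity satisfy an exponential Markov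
inequality as if they were independent, up to an additive error of order `N α(l)`. This error is
not inflated by the number of factors because the exponential products are frozen once they reach
the level under consideration.

Put `θ = (2 - p) / p` and define the number `m` of effectively independent blocks by
`R² t = 4 m ^ (1 + θ) (θ / c') ^ θ`; the claimed bound is then `exp (-θ m)`. Two choices of `N`
reach it. If `R ^ (-1 / θ) ≤ 16`, take `N` of order `m / R`: the event forces at least `N R / 4` of
the block averages to be `≥ R / 2`, and the exponential moment of their number with parameter
`16 θ` is controlled by Chebyshev's inequality. If `R ^ (-1 / θ) ≥ 16`, take `N` of order
`θ m / R` and use the exponential moments of the block averages themselves: the blocks are still so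
long that `N α(l)` is smaller than `exp (-θ m)`.
-/

section ConditionalExpectation

variable {Ω : Type*} {m m0 : MeasurableSpace Ω} {P : Measure Ω}

theorem integral_condExp_mul (hm : m ≤ m0) [SigmaFinite (P.trim hm)] {f g : Ω → ℝ}
    (hf : Integrable f P) (hg : AEStronglyMeasurable[m] g P)
    (hfg : Integrable (fun ω => f ω * g ω) P) :
    ∫ ω, P[f|m] ω * g ω ∂P = ∫ ω, f ω * g ω ∂P := by
  rw [← integral_condExp hm (f := fun ω => f ω * g ω)]
  exact (integral_congr_ae (condExp_mul_of_aestronglyMeasurable_right hg hfg hf)).symm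

theorem integral_sub_condExp_mul_eq_zero (hm : m ≤ m0) [SigmaFinite (P.trim hm)] {f g : Ω → ℝ}
    (hf : Integrable f P) (hg : AEStronglyMeasurable[m] g P)
    (hfg : Integrable (fun ω => f ω * g ω) P) :
    ∫ ω, (f ω - P[f|m] ω) * g ω ∂P = 0 := by
  have hint : Integrable (fun ω => P[f|m] ω * g ω) P :=
    integrable_condExp.congr (condExp_mul_of_aestronglyMeasurable_right hg hfg hf)
  simp_rw [sub_mul]
  rw [integral_sub hfg hint, integral_condExp_mul hm hf hg hfg, sub_self]

theorem integrable_of_forall_abs_le [IsFiniteMeasure P] {f : Ω → ℝ}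
    (hf : AEStronglyMeasurable f P) {C : ℝ} (hC : ∀ ω, |f ω| ≤ C) : Integrable f P :=
  .of_bound hf C (ae_of_all _ hC)

theorem abs_integral_le_of_forall_abs_le [IsProbabilityMeasure P] {f : Ω → ℝ} {C : ℝ}
    (hC : ∀ ω, |f ω| ≤ C) : |∫ ω, f ω ∂P| ≤ C := by
  simpa using norm_integral_le_of_norm_le_const (μ := P) (f := f) (ae_of_all _ hC)

theorem aestronglyMeasurable_of_integral_sub_condExp_mul_self_eq_zero (hm : m ≤ m0)
    [IsFiniteMeasure P] {f : Ω → ℝ} (hf : AEStronglyMeasurable f P) {C : ℝ} (hC : ∀ ω, |f ω| ≤ C)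
    (horth : ∫ ω, (f ω - P[f|m] ω) * f ω ∂P = 0) : AEStronglyMeasurable[m] f P := by
  have hfint : Integrable f P := integrable_of_forall_abs_le hf hC
  have hcondBdd : ∀ᵐ ω ∂P, |P[f|m] ω| ≤ C := ae_bdd_abs_condExp_of_ae_bdd_abs (ae_of_all _ hC)
  have hcond : AEStronglyMeasurable (P[f|m]) P := integrable_condExp.aestronglyMeasurable
  set D : Ω → ℝ := fun ω => f ω - P[f|m] ω
  have hD : Integrable D P := hfint.sub integrable_condExp
  have hDf : Integrable (fun ω => D ω * f ω) P := hD.mul_bdd hf (ae_of_all _ hC)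
  have hDcond : Integrable (fun ω => D ω * P[f|m] ω) P := hD.mul_bdd hcond hcondBdd
  have hsq : (fun ω => D ω * D ω) = fun ω => D ω * f ω - D ω * P[f|m] ω :=
    funext fun ω => mul_sub _ _ _
  have hsq_integral : ∫ ω, D ω * D ω ∂P = 0 := by
    rw [hsq, integral_sub hDf hDcond, horth, integral_sub_condExp_mul_eq_zero hm hfint
      stronglyMeasurable_condExp.aestronglyMeasurable (hfint.mul_bdd hcond hcondBdd), sub_self]
  have hDzero : (fun ω => D ω * D ω) =ᵐ[P] 0 :=
    (integral_eq_zero_iff_of_nonneg (fun ω => mul_self_nonneg _)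
      (hsq ▸ hDf.sub hDcond)).1 hsq_integral
  exact ⟨P[f|m], stronglyMeasurable_condExp,
    hDzero.mono fun ω hω => sub_eq_zero.1 (mul_self_eq_zero.1 hω)⟩

theorem aestronglyMeasurable_integral_of_ae (hm : m ≤ m0) [IsFiniteMeasure P] {S : Type*}
    [MeasurableSpace S] {ν : Measure S} [IsFiniteMeasure ν] {Y : S → Ω → ℝ}
    (hY : Measurable (Function.uncurry Y)) {K : ℝ} (hK : ∀ s ω, |Y s ω| ≤ K)
    (hYm : ∀ᵐ s ∂ν, AEStronglyMeasurable[m] (Y s) P) :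
    AEStronglyMeasurable[m] (fun ω => ∫ s, Y s ω ∂ν) P := by
  set I : Ω → ℝ := fun ω => ∫ s, Y s ω ∂ν
  have hswap : Measurable (Function.uncurry fun ω s => Y s ω) := hY.comp measurable_swap
  have hI : AEStronglyMeasurable I P :=
    hswap.stronglyMeasurable.integral_prod_right.aestronglyMeasurable
  have hIK : ∀ ω, |I ω| ≤ K * ν.real Set.univ := fun ω =>
    norm_integral_le_of_norm_le_const (f := fun s => Y s ω) (ae_of_all _ fun s => hK s ω)
  have hIint : Integrable I P := integrable_of_forall_abs_le hI hIK
  refine aestronglyMeasurable_of_integral_sub_condExp_mul_self_eq_zero hm hI hIK ?_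
  have hDY : Integrable (Function.uncurry fun ω s => (I ω - P[I|m] ω) * Y s ω) (P.prod ν) :=
    ((hIint.sub integrable_condExp).comp_fst ν).mul_bdd (c := K) hswap.aestronglyMeasurable
      (ae_of_all _ fun z => hK z.2 z.1)
  calc ∫ ω, (I ω - P[I|m] ω) * I ω ∂P = ∫ ω, ∫ s, (I ω - P[I|m] ω) * Y s ω ∂ν ∂P := by
        simp only [I, integral_const_mul]
    _ = ∫ s, ∫ ω, (I ω - P[I|m] ω) * Y s ω ∂P ∂ν := integral_integral_swap hDY
    _ = 0 := integral_eq_zero_of_ae <| hYm.mono fun s hs =>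
        integral_sub_condExp_mul_eq_zero hm hIint hs <| hIint.mul_bdd (c := K)
          (hY.comp measurable_prodMk_left).aestronglyMeasurable (ae_of_all _ (hK s))

theorem setIntegral_eq_zero_of_isPiSystem (hm : m ≤ m0) {h : Ω → ℝ} (hh : Integrable h P)
    {C : Set (Set Ω)} (hmC : m = MeasurableSpace.generateFrom C) (hC : IsPiSystem C)
    (huniv : ∫ ω, h ω ∂P = 0) (hzero : ∀ B ∈ C, ∫ ω in B, h ω ∂P = 0) {B : Set Ω}
    (hB : MeasurableSet[m] B) : ∫ ω in B, h ω ∂P = 0 := by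
  induction B, hB using MeasurableSpace.induction_on_inter hmC hC with
  | empty => simp
  | basic t ht => exact hzero t ht
  | compl t ht ih => rw [setIntegral_compl (hm _ ht) hh, huniv, ih, sub_zero]
  | iUnion f hd hf ih =>
    rw [integral_iUnion (fun i => hm _ (hf i)) hd hh.integrableOn]
    simp [ih]

end ConditionalExpectation

theorem aestronglyMeasurable_comp {Ω : Type*} {m m0 : MeasurableSpace Ω} {P : Measure Ω}
    {f : Ω → ℝ} {φ : ℝ → ℝ} (hφ : Measurable φ) (hf : AEStronglyMeasurable[m] f P) :
    AEStronglyMeasurable[m] (fun ω => φ (f ω)) P :=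
  ⟨_, (hφ.comp hf.stronglyMeasurable_mk.measurable).stronglyMeasurable, hf.ae_eq_mk.fun_comp φ⟩

/-! ### Sums of mixing sequences -/

/-- A sequence `ξ` each of whose terms is almost independent of the information preceding it:
`𝓕 k` is the information available just before `ξ k`, and `β` bounds the dependence, as a strong
(`α`-)mixing coefficient does. Measurability is only required up to `P`-null sets. -/
structure IsMixingSequence {Ω : Type*} [m0 : MeasurableSpace Ω] (𝓕 : ℕ → MeasurableSpace Ω)
    (ξ : ℕ → Ω → ℝ) (β : ℝ) (P : Measure Ω) : Prop where
  le : ∀ k, 𝓕 k ≤ m0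
  mono : Monotone 𝓕
  adapted : ∀ k, AEStronglyMeasurable[𝓕 (k + 1)] (ξ k) P
  decoupling : ∀ (k : ℕ) {F : Ω → ℝ} {φ : ℝ → ℝ} {L D : ℝ}, AEStronglyMeasurable[𝓕 k] F P →
    Measurable φ → (∀ ω, |F ω| ≤ L) → (∀ ω, |φ (ξ k ω)| ≤ D) →
    ∫ ω, F ω * φ (ξ k ω) ∂P ≤ (∫ ω, F ω ∂P) * ∫ ω, φ (ξ k ω) ∂P + β * L * D

/-- The partial products of `Y`, frozen once they reach the level `b`. Freezing keeps the
products bounded before each multiplication, however many factors there are. -/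
noncomputable def stoppedProduct {Ω : Type*} (b : ℝ) (Y : ℕ → Ω → ℝ) : ℕ → Ω → ℝ
  | 0, _ => 1
  | k + 1, ω => if b ≤ stoppedProduct b Y k ω then stoppedProduct b Y k ω
      else stoppedProduct b Y k ω * Y k ω

namespace stoppedProduct

variable {Ω : Type*} {b : ℝ} {Y : ℕ → Ω → ℝ}

theorem succ_eq (k : ℕ) (ω : Ω) :
    stoppedProduct b Y (k + 1) ω = (Set.Ici b).indicator id (stoppedProduct b Y k ω)
      + (Set.Iio b).indicator id (stoppedProduct b Y k ω) * Y k ω := by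
  by_cases h : b ≤ stoppedProduct b Y k ω <;>
    simp [stoppedProduct, h, not_lt.2, not_le.1]

theorem nonneg (hY : ∀ k ω, 0 ≤ Y k ω) (k : ℕ) (ω : Ω) : 0 ≤ stoppedProduct b Y k ω := by
  induction k with
  | zero => exact zero_le_one
  | succ k ih =>
    simp only [stoppedProduct]
    split_ifs
    exacts [ih, mul_nonneg ih (hY k ω)]

theorem le_pow {D : ℝ} (hY : ∀ k ω, 0 ≤ Y k ω) (hD : 1 ≤ D) (hYD : ∀ k ω, Y k ω ≤ D) (k : ℕ)
    (ω : Ω) : stoppedProduct b Y k ω ≤ D ^ k := by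
  induction k with
  | zero => simp [stoppedProduct]
  | succ k ih =>
    simp only [stoppedProduct, pow_succ]
    split_ifs
    · exact ih.trans (le_mul_of_one_le_right (by positivity) hD)
    · exact mul_le_mul ih (hYD k ω) (hY k ω) (by positivity)

theorem eq_prod_of_lt {k : ℕ} {ω : Ω} (h : stoppedProduct b Y k ω < b) :
    stoppedProduct b Y k ω = ∏ j ∈ Finset.range k, Y j ω := by
  induction k with
  | zero => simp [stoppedProduct]
  | succ k ih =>
    simp only [stoppedProduct] at h ⊢
    split_ifs at h ⊢ with hk
    · exact absurd h hk.not_gt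
    · rw [Finset.prod_range_succ, ih (not_le.1 hk)]

theorem aestronglyMeasurable {m0 : MeasurableSpace Ω} {P : Measure Ω}
    {𝓕 : ℕ → MeasurableSpace Ω} (h𝓕 : Monotone 𝓕)
    (hY : ∀ k, AEStronglyMeasurable[𝓕 (k + 1)] (Y k) P) (k : ℕ) :
    AEStronglyMeasurable[𝓕 k] (stoppedProduct b Y k) P := by
  induction k with
  | zero => exact aestronglyMeasurable_const
  | succ k ih =>
    rw [funext (succ_eq (b := b) (Y := Y) k)]
    have hU := ih.mono (h𝓕 k.le_succ)
    exact (aestronglyMeasurable_comp (measurable_id.indicator measurableSet_Ici) hU).add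
      ((aestronglyMeasurable_comp (measurable_id.indicator measurableSet_Iio) hU).mul (hY k))

theorem abs_indicator_Iio_le {L : ℝ} (hY : ∀ k ω, 0 ≤ Y k ω) (hL : 0 ≤ L)
    (hbL : ∀ k ω, ∏ j ∈ Finset.range k, Y j ω < b → ∏ j ∈ Finset.range k, Y j ω ≤ L)
    (k : ℕ) (ω : Ω) : |(Set.Iio b).indicator id (stoppedProduct b Y k ω)| ≤ L := by
  by_cases hω : stoppedProduct b Y k ω < b
  · have hprod := eq_prod_of_lt hω
    simpa [hω, abs_of_nonneg (nonneg hY k ω)] using hprod.trans_le (hbL k ω (hprod ▸ hω))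
  · simpa [hω] using hL

theorem integrable [MeasurableSpace Ω] {P : Measure Ω} [IsFiniteMeasure P] {D : ℝ}
    (hY : ∀ k ω, 0 ≤ Y k ω) (hD : 1 ≤ D) (hYD : ∀ k ω, Y k ω ≤ D) {k : ℕ}
    (hm : AEStronglyMeasurable (stoppedProduct b Y k) P) :
    Integrable (stoppedProduct b Y k) P :=
  integrable_of_forall_abs_le hm fun ω =>
    (abs_of_nonneg (nonneg hY k ω)).trans_le (le_pow hY hD hYD k ω)

end stoppedProduct

namespace IsMixingSequence

variable {Ω : Type*} [MeasurableSpace Ω] {𝓕 : ℕ → MeasurableSpace Ω} {ξ : ℕ → Ω → ℝ}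
  {β : ℝ} {P : Measure Ω} [IsProbabilityMeasure P] {φ : ℝ → ℝ} {b D G L : ℝ}

theorem integral_stoppedProduct_succ_le (h : IsMixingSequence 𝓕 ξ β P)
    (hφ : Measurable φ) (hφ0 : ∀ x, 0 ≤ φ x) (hD : 1 ≤ D) (hφD : ∀ k ω, φ (ξ k ω) ≤ D)
    (hG : 1 ≤ G) (hφG : ∀ k, ∫ ω, φ (ξ k ω) ∂P ≤ G) (hL : 0 ≤ L)
    (hbL : ∀ k ω, ∏ j ∈ Finset.range k, φ (ξ j ω) < b → ∏ j ∈ Finset.range k, φ (ξ j ω) ≤ L)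
    (k : ℕ) :
    ∫ ω, stoppedProduct b (fun j ω => φ (ξ j ω)) (k + 1) ω ∂P
      ≤ G * ∫ ω, stoppedProduct b (fun j ω => φ (ξ j ω)) k ω ∂P + β * L * D := by
  set Y : ℕ → Ω → ℝ := fun j ω => φ (ξ j ω)
  set U := stoppedProduct b Y
  have hY0 (j : ℕ) (ω : Ω) : 0 ≤ Y j ω := hφ0 _
  have hYabs (ω : Ω) : |Y k ω| ≤ D := (abs_of_nonneg (hY0 k ω)).trans_le (hφD k ω)
  have hYm (j : ℕ) : AEStronglyMeasurable[𝓕 (j + 1)] (Y j) P :=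
    aestronglyMeasurable_comp hφ (h.adapted j)
  have hUm : AEStronglyMeasurable[𝓕 k] (U k) P := stoppedProduct.aestronglyMeasurable h.mono hYm k
  have hU0 (ω : Ω) : 0 ≤ U k ω := stoppedProduct.nonneg hY0 k ω
  have hUint : Integrable (U k) P := stoppedProduct.integrable hY0 hD hφD (hUm.mono (h.le k))
  set frozen : Ω → ℝ := fun ω => (Set.Ici b).indicator id (U k ω)
  set active : Ω → ℝ := fun ω => (Set.Iio b).indicator id (U k ω)
  have hactive : ∀ ω, |active ω| ≤ L := stoppedProduct.abs_indicator_Iio_le hY0 hL hbL k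
  have hactive_meas : AEStronglyMeasurable[𝓕 k] active P :=
    aestronglyMeasurable_comp (measurable_id.indicator measurableSet_Iio) hUm
  have hactive_int : Integrable active P :=
    integrable_of_forall_abs_le (hactive_meas.mono (h.le k)) hactive
  have hfrozen : frozen = U k - active := funext fun ω => by
    by_cases hω : b ≤ U k ω <;> simp [frozen, active, hω, not_lt.2, not_le.1]
  have hfrozen_int : Integrable frozen P := hfrozen ▸ hUint.sub hactive_int
  calc ∫ ω, U (k + 1) ω ∂P = ∫ ω, frozen ω ∂P + ∫ ω, active ω * Y k ω ∂P := by
        rw [← integral_add hfrozen_int (hactive_int.mul_bdd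
          ((hYm k).mono (h.le _)) (ae_of_all _ hYabs))]
        exact integral_congr_ae (ae_of_all _ fun ω => stoppedProduct.succ_eq k ω)
    _ ≤ ∫ ω, frozen ω ∂P + ((∫ ω, active ω ∂P) * ∫ ω, Y k ω ∂P + β * L * D) := by
        gcongr
        exact h.decoupling k hactive_meas hφ hactive hYabs
    _ ≤ G * ∫ ω, frozen ω ∂P + (G * ∫ ω, active ω ∂P + β * L * D) := by
        rw [mul_comm G (∫ ω, active ω ∂P)]
        gcongr
        · exact le_mul_of_one_le_left
            (integral_nonneg fun ω => Set.indicator_apply_nonneg fun _ => hU0 ω) hG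
        · exact integral_nonneg fun ω => Set.indicator_apply_nonneg fun _ => hU0 ω
        · exact hφG k
    _ = G * ∫ ω, U k ω ∂P + β * L * D := by
        rw [hfrozen, integral_sub' hUint hactive_int]
        ring

theorem integral_stoppedProduct_le (h : IsMixingSequence 𝓕 ξ β P) (hβ : 0 ≤ β)
    (hφ : Measurable φ) (hφ0 : ∀ x, 0 ≤ φ x) (hD : 1 ≤ D) (hφD : ∀ k ω, φ (ξ k ω) ≤ D)
    (hG : 1 ≤ G) (hφG : ∀ k, ∫ ω, φ (ξ k ω) ∂P ≤ G) (hL : 0 ≤ L)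
    (hbL : ∀ k ω, ∏ j ∈ Finset.range k, φ (ξ j ω) < b → ∏ j ∈ Finset.range k, φ (ξ j ω) ≤ L)
    (N : ℕ) :
    ∫ ω, stoppedProduct b (fun j ω => φ (ξ j ω)) N ω ∂P ≤ G ^ N * (1 + N * (β * L * D)) := by
  have herror : 0 ≤ β * L * D := by positivity
  induction N with
  | zero => simp [stoppedProduct]
  | succ k ih =>
    calc ∫ ω, stoppedProduct b (fun j ω => φ (ξ j ω)) (k + 1) ω ∂P
        ≤ G * ∫ ω, stoppedProduct b (fun j ω => φ (ξ j ω)) k ω ∂P + β * L * D :=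
          h.integral_stoppedProduct_succ_le hφ hφ0 hD hφD hG hφG hL hbL k
      _ ≤ G * (G ^ k * (1 + k * (β * L * D))) + G ^ (k + 1) * (β * L * D) := by
          exact add_le_add (by gcongr) (le_mul_of_one_le_left herror (one_le_pow₀ hG))
      _ = G ^ (k + 1) * (1 + (k + 1 : ℕ) * (β * L * D)) := by push_cast; ring

theorem measureReal_le_prod_le (h : IsMixingSequence 𝓕 ξ β P) (hβ : 0 ≤ β)
    (hφ : Measurable φ) (hφ0 : ∀ x, 0 ≤ φ x) (hD : 1 ≤ D) (hφD : ∀ k ω, φ (ξ k ω) ≤ D)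
    (hG : 1 ≤ G) (hφG : ∀ k, ∫ ω, φ (ξ k ω) ∂P ≤ G) (hL : 0 ≤ L) (hb : 0 < b)
    (hbL : ∀ k ω, ∏ j ∈ Finset.range k, φ (ξ j ω) < b → ∏ j ∈ Finset.range k, φ (ξ j ω) ≤ L)
    (N : ℕ) :
    P.real {ω | b ≤ ∏ j ∈ Finset.range N, φ (ξ j ω)} ≤ G ^ N * (1 + N * (β * L * D)) / b := by
  have hY0 (j : ℕ) (ω : Ω) : 0 ≤ φ (ξ j ω) := hφ0 _
  set U := stoppedProduct b (fun j ω => φ (ξ j ω))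
  have hUint : Integrable (U N) P := stoppedProduct.integrable hY0 hD hφD <|
    (stoppedProduct.aestronglyMeasurable h.mono
      (fun j => aestronglyMeasurable_comp hφ (h.adapted j)) N).mono (h.le N)
  have hsub : {ω | b ≤ ∏ j ∈ Finset.range N, φ (ξ j ω)} ⊆ {ω | b ≤ U N ω} := fun ω hω =>
    not_lt.1 fun hlt => hω.not_gt (stoppedProduct.eq_prod_of_lt hlt ▸ hlt)
  rw [le_div_iff₀' hb]
  calc b * P.real {ω | b ≤ ∏ j ∈ Finset.range N, φ (ξ j ω)} ≤ b * P.real {ω | b ≤ U N ω} := by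
        exact mul_le_mul_of_nonneg_left (measureReal_mono hsub) hb.le
    _ ≤ ∫ ω, U N ω ∂P :=
      mul_meas_ge_le_integral_of_nonneg (ae_of_all _ (stoppedProduct.nonneg hY0 N)) hUint b
    _ ≤ G ^ N * (1 + N * (β * L * D)) :=
      h.integral_stoppedProduct_le hβ hφ hφ0 hD hφD hG hφG hL hbL N

theorem integrable_sq (h : IsMixingSequence 𝓕 ξ β P) {B : ℝ} (hξ : ∀ k ω, |ξ k ω| ≤ B) (k : ℕ) :
    Integrable (fun ω => ξ k ω ^ 2) P :=
  integrable_of_forall_abs_le (C := B ^ 2)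
    ((aestronglyMeasurable_comp (measurable_id.pow_const 2) (h.adapted k)).mono (h.le _))
    fun ω => by
      rw [abs_pow]
      exact pow_le_pow_left₀ (abs_nonneg _) (hξ k ω) 2

theorem integral_exp_mul_le (h : IsMixingSequence 𝓕 ξ β P) {B l v : ℝ}
    (hξ : ∀ k ω, |ξ k ω| ≤ B) (hl : 0 ≤ l) (hlB : l * B ≤ 1) (hmean : ∀ k, ∫ ω, ξ k ω ∂P = 0)
    (hvar : ∀ k, ∫ ω, ξ k ω ^ 2 ∂P ≤ v) (k : ℕ) :
    ∫ ω, Real.exp (l * ξ k ω) ∂P ≤ 1 + l ^ 2 * v := by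
  have hξint : Integrable (ξ k) P :=
    integrable_of_forall_abs_le ((h.adapted k).mono (h.le _)) (hξ k)
  have hquad (ω : Ω) : Real.exp (l * ξ k ω) ≤ 1 + l * ξ k ω + l ^ 2 * ξ k ω ^ 2 := by
    have hsmall : |l * ξ k ω| ≤ 1 := by
      rw [abs_mul, abs_of_nonneg hl]
      exact (mul_le_mul_of_nonneg_left (hξ k ω) hl).trans hlB
    linarith [(abs_le.1 (Real.abs_exp_sub_one_sub_id_le hsmall)).2, mul_pow l (ξ k ω) 2]
  have hlin : Integrable (fun ω => 1 + l * ξ k ω) P :=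
    (integrable_const 1).add (hξint.const_mul l)
  have hsq : Integrable (fun ω => l ^ 2 * ξ k ω ^ 2) P := (h.integrable_sq hξ k).const_mul _
  calc ∫ ω, Real.exp (l * ξ k ω) ∂P ≤ ∫ ω, 1 + l * ξ k ω + l ^ 2 * ξ k ω ^ 2 ∂P :=
        integral_mono_of_nonneg (ae_of_all _ fun _ => (Real.exp_pos _).le) (hlin.add hsq)
          (ae_of_all _ hquad)
    _ = 1 + l ^ 2 * ∫ ω, ξ k ω ^ 2 ∂P := by
        rw [integral_add hlin hsq, integral_add (integrable_const 1) (hξint.const_mul l),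
          integral_const_mul, integral_const_mul, hmean k]
        simp
    _ ≤ 1 + l ^ 2 * v := by gcongr; exact hvar k

theorem measureReal_le_sum_le (h : IsMixingSequence 𝓕 ξ β P) (hβ : 0 ≤ β) {B l v : ℝ}
    (hξ : ∀ k ω, |ξ k ω| ≤ B) (hl : 0 ≤ l) (hlB : l * B ≤ 1) (hmean : ∀ k, ∫ ω, ξ k ω ∂P = 0)
    (hvar : ∀ k, ∫ ω, ξ k ω ^ 2 ∂P ≤ v) (N : ℕ) (x : ℝ) :
    P.real {ω | x ≤ ∑ j ∈ Finset.range N, ξ j ω}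
      ≤ (1 + l ^ 2 * v) ^ N * (Real.exp (-(l * x)) + N * β * Real.exp (l * B)) := by
  obtain ⟨ω₀⟩ : Nonempty Ω := P.nonempty_of_neZero
  have hB : 0 ≤ B := (abs_nonneg _).trans (hξ 0 ω₀)
  have hv : 0 ≤ v := (integral_nonneg fun ω => sq_nonneg (ξ 0 ω)).trans (hvar 0)
  calc P.real {ω | x ≤ ∑ j ∈ Finset.range N, ξ j ω}
      ≤ P.real {ω | Real.exp (l * x) ≤ ∏ j ∈ Finset.range N, Real.exp (l * ξ j ω)} := by
        refine measureReal_mono fun ω (hω : x ≤ _) => ?_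
        rw [Set.mem_ofPred_eq, ← Real.exp_sum, ← Finset.mul_sum]
        gcongr
    _ ≤ (1 + l ^ 2 * v) ^ N * (1 + N * (β * Real.exp (l * x) * Real.exp (l * B)))
          / Real.exp (l * x) := by
        refine h.measureReal_le_prod_le (φ := fun y => Real.exp (l * y)) hβ (by fun_prop)
          (fun _ => (Real.exp_pos _).le) (Real.one_le_exp (by positivity)) (fun k ω => ?_)
          (le_add_of_nonneg_right (by positivity)) (h.integral_exp_mul_le hξ hl hlB hmean hvar)
          (Real.exp_pos _).le (Real.exp_pos _) (fun _ _ hlt => hlt.le) N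
        gcongr
        exact (abs_le.1 (hξ k ω)).2
    _ = (1 + l ^ 2 * v) ^ N * (Real.exp (-(l * x)) + N * β * Real.exp (l * B)) := by
        rw [Real.exp_neg]
        field_simp

theorem integral_ite_exp_le (h : IsMixingSequence 𝓕 ξ β P) {B l v y : ℝ}
    (hξ : ∀ k ω, |ξ k ω| ≤ B) (hy : 0 < y) (hvar : ∀ k, ∫ ω, ξ k ω ^ 2 ∂P ≤ v) (k : ℕ) :
    ∫ ω, (if y ≤ ξ k ω then Real.exp l else 1) ∂P ≤ 1 + Real.exp l * (v / y ^ 2) := by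
  have hchebyshev (ω : Ω) : (if y ≤ ξ k ω then Real.exp l else 1)
      ≤ 1 + Real.exp l / y ^ 2 * ξ k ω ^ 2 := by
    split_ifs with hyξ
    · have hratio : 1 ≤ ξ k ω ^ 2 / y ^ 2 := by
        rw [one_le_div (by positivity)]
        gcongr
      calc Real.exp l ≤ Real.exp l * (ξ k ω ^ 2 / y ^ 2) :=
            le_mul_of_one_le_right (Real.exp_pos _).le hratio
        _ = Real.exp l / y ^ 2 * ξ k ω ^ 2 := by ring
        _ ≤ 1 + Real.exp l / y ^ 2 * ξ k ω ^ 2 := le_add_of_nonneg_left zero_le_one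
    · exact le_add_of_nonneg_right (by positivity)
  have hsq : Integrable (fun ω => Real.exp l / y ^ 2 * ξ k ω ^ 2) P :=
    (h.integrable_sq hξ k).const_mul _
  calc ∫ ω, (if y ≤ ξ k ω then Real.exp l else 1) ∂P
      ≤ ∫ ω, 1 + Real.exp l / y ^ 2 * ξ k ω ^ 2 ∂P :=
        integral_mono_of_nonneg (ae_of_all _ fun ω => by positivity)
          ((integrable_const 1).add hsq) (ae_of_all _ hchebyshev)
    _ = 1 + Real.exp l / y ^ 2 * ∫ ω, ξ k ω ^ 2 ∂P := by
        rw [integral_add (integrable_const 1) hsq, integral_const_mul]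
        simp
    _ ≤ 1 + Real.exp l / y ^ 2 * v := by gcongr; exact hvar k
    _ = 1 + Real.exp l * (v / y ^ 2) := by ring

theorem measureReal_le_card_filter_le (h : IsMixingSequence 𝓕 ξ β P) (hβ : 0 ≤ β)
    {B l v y : ℝ} (hξ : ∀ k ω, |ξ k ω| ≤ B) (hl : 0 ≤ l) (hy : 0 < y)
    (hvar : ∀ k, ∫ ω, ξ k ω ^ 2 ∂P ≤ v) (N n : ℕ) :
    P.real {ω | n ≤ {j ∈ Finset.range N | y ≤ ξ j ω}.card}
      ≤ (1 + Real.exp l * (v / y ^ 2)) ^ N * (Real.exp (-(l * n)) + N * β) := by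
  have hv : 0 ≤ v := (integral_nonneg fun ω => sq_nonneg (ξ 0 ω)).trans (hvar 0)
  have hprod (N : ℕ) (ω : Ω) : ∏ j ∈ Finset.range N, (if y ≤ ξ j ω then Real.exp l else 1)
      = Real.exp (l * {j ∈ Finset.range N | y ≤ ξ j ω}.card) := by
    rw [Finset.prod_ite, Finset.prod_const, Finset.prod_const_one, mul_one, ← Real.exp_nat_mul,
      mul_comm]
  calc P.real {ω | n ≤ {j ∈ Finset.range N | y ≤ ξ j ω}.card}
      ≤ P.real {ω | Real.exp (l * n)
          ≤ ∏ j ∈ Finset.range N, (if y ≤ ξ j ω then Real.exp l else 1)} := by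
        refine measureReal_mono fun ω (hω : n ≤ _) => ?_
        rw [Set.mem_ofPred_eq, hprod]
        gcongr
    _ ≤ (1 + Real.exp l * (v / y ^ 2)) ^ N
          * (1 + N * (β * Real.exp (l * (n - 1)) * Real.exp l)) / Real.exp (l * n) := by
        refine h.measureReal_le_prod_le (φ := fun x => if y ≤ x then Real.exp l else 1) hβ
          (.ite measurableSet_Ici measurable_const measurable_const)
          (fun _ => by positivity) (Real.one_le_exp hl) (fun k ω => ?_)
          (le_add_of_nonneg_right (by positivity)) (h.integral_ite_exp_le hξ hy hvar)
          (Real.exp_pos _).le (Real.exp_pos _) (fun k ω hlt => ?_) N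
        · split_ifs
          exacts [le_rfl, Real.one_le_exp hl]
        · rw [hprod] at hlt ⊢
          have hcard : {j ∈ Finset.range k | y ≤ ξ j ω}.card < n := by
            by_contra! hn
            exact hlt.not_ge (by gcongr)
          gcongr
          exact le_sub_iff_add_le.2 (mod_cast hcard)
    _ = (1 + Real.exp l * (v / y ^ 2)) ^ N * (Real.exp (-(l * n)) + N * β) := by
        have hexp : Real.exp (l * (n - 1)) * Real.exp l = Real.exp (l * n) := by
          rw [← Real.exp_add]
          ring_nf
        rw [mul_assoc β, hexp, Real.exp_neg]
        field_simp

end IsMixingSequence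

theorem memLp_two_of_forall_abs_le {Ω : Type*} [MeasurableSpace Ω] {P : Measure Ω}
    [IsFiniteMeasure P] {f : Ω → ℝ} (hf : Measurable f) {C : ℝ} (hC : ∀ ω, |f ω| ≤ C) :
    MemLp f 2 P :=
  .of_bound hf.aestronglyMeasurable C (ae_of_all _ hC)

theorem exists_integral_abs_sub_integral_eq_covariance {Ω : Type*} [MeasurableSpace Ω]
    {P : Measure Ω} [IsProbabilityMeasure P] {f : Ω → ℝ} (hf : Measurable f) {C : ℝ}
    (hC : ∀ ω, |f ω| ≤ C) :
    ∃ σ : Ω → ℝ, Measurable σ ∧ (∀ ω, |σ ω| ≤ 1) ∧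
      ∫ ω, |f ω - ∫ ω', f ω' ∂P| ∂P = cov[σ, f; P] := by
  set c : ℝ := ∫ ω, f ω ∂P
  set σ : Ω → ℝ := fun ω => if c ≤ f ω then 1 else -1
  have hσ : Measurable σ :=
    .ite (measurableSet_le measurable_const hf) measurable_const measurable_const
  have hσ1 (ω : Ω) : |σ ω| ≤ 1 := by
    simp only [σ]
    split_ifs <;> simp
  have habs (ω : Ω) : |f ω - c| = σ ω * (f ω - c) := by
    simp only [σ]
    split_ifs with h
    · rw [abs_of_nonneg (sub_nonneg.2 h), one_mul]
    · rw [abs_of_neg (sub_neg.2 (not_le.1 h)), neg_one_mul]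
  have hfint : Integrable f P := integrable_of_forall_abs_le hf.aestronglyMeasurable hC
  have hfc : Integrable (fun ω => f ω - c) P := hfint.sub (integrable_const c)
  have hσf : Integrable (fun ω => σ ω * (f ω - c)) P :=
    hfc.bdd_mul hσ.aestronglyMeasurable (ae_of_all _ hσ1)
  refine ⟨σ, hσ, hσ1, ?_⟩
  have hzero : ∫ ω, (f ω - c) ∂P = 0 := by
    rw [integral_sub hfint (integrable_const c), integral_const, probReal_univ, one_smul, sub_self]
  calc ∫ ω, |f ω - c| ∂P = ∫ ω, σ ω * (f ω - c) ∂P := integral_congr_ae (ae_of_all _ habs)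
    _ = ∫ ω, σ ω * (f ω - c) ∂P - ∫ ω, P[σ] * (f ω - c) ∂P := by
        rw [integral_const_mul, hzero, mul_zero, sub_zero]
    _ = cov[σ, f; P] := by
        rw [covariance, ← integral_sub hσf (hfc.const_mul _)]
        simp_rw [sub_mul]
        rfl

theorem covariance_le_sqrt_variance_mul_sqrt_variance {Ω : Type*} [MeasurableSpace Ω]
    {P : Measure Ω} [IsProbabilityMeasure P] {X Y : Ω → ℝ} (hX : MemLp X 2 P) (hY : MemLp Y 2 P) :
    cov[X, Y; P] ≤ √Var[X; P] * √Var[Y; P] := by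
  have hX' : MemLp (fun ω => X ω - P[X]) 2 P := hX.sub (memLp_const _)
  have hY' : MemLp (fun ω => Y ω - P[Y]) 2 P := hY.sub (memLp_const _)
  have h := integral_mul_norm_le_Lp_mul_Lq (μ := P) Real.HolderConjugate.two_two
    (by simpa using hX') (by simpa using hY')
  simp_rw [Real.norm_eq_abs, Real.rpow_two, sq_abs, ← Real.sqrt_eq_rpow] at h
  rw [variance_eq_integral hX.1.aemeasurable, variance_eq_integral hY.1.aemeasurable]
  refine le_trans (integral_mono (hX'.integrable_mul hY') ?_ fun ω => ?_) h
  · simpa [abs_mul] using (hX'.integrable_mul hY').abs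
  · rw [← abs_mul]
    exact le_abs_self _

theorem exists_condExp_comap_ae_eq {Ω S : Type*} [MeasurableSpace Ω] [MeasurableSpace S]
    {P : Measure Ω} [IsProbabilityMeasure P] {X : Ω → S} {G : Ω → ℝ} {D : ℝ}
    (hG : ∀ ω, |G ω| ≤ D) :
    ∃ h : S → ℝ, Measurable h ∧ (∀ x, |h x| ≤ D) ∧
      P[G|MeasurableSpace.comap X inferInstance] =ᵐ[P] fun ω => h (X ω) := by
  obtain ⟨h, hh, hGh⟩ := (stronglyMeasurable_condExp (μ := P) (f := G)
    (m := MeasurableSpace.comap X inferInstance)).exists_eq_measurable_comp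
  obtain ⟨ω₀⟩ : Nonempty Ω := P.nonempty_of_neZero
  have hD : -D ≤ D := by linarith [abs_nonneg (G ω₀), hG ω₀]
  refine ⟨fun x => max (-D) (min D (h x)),
    measurable_const.max (measurable_const.min hh.measurable),
    fun x => abs_le.2 ⟨le_max_left _ _, max_le hD (min_le_left _ _)⟩, ?_⟩
  have hbound : ∀ᵐ ω ∂P, |P[G|MeasurableSpace.comap X inferInstance] ω| ≤ D :=
    ae_bdd_abs_condExp_of_ae_bdd_abs (ae_of_all _ hG)
  filter_upwards [hbound] with ω hω
  rw [hGh, Function.comp_apply, abs_le] at hω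
  rw [hGh, Function.comp_apply, min_eq_right hω.2, max_eq_right hω.1]

theorem integral_sq_integral_le {Ω S : Type*} [MeasurableSpace Ω] [MeasurableSpace S]
    {P : Measure Ω} [IsFiniteMeasure P] {ν : Measure S} [IsFiniteMeasure ν] {Y : S → Ω → ℝ}
    (hY : Measurable (Function.uncurry Y)) {K C : ℝ} (hK : ∀ s ω, |Y s ω| ≤ K)
    (hC : ∀ u, ∫ s, ∫ ω, Y s ω * Y u ω ∂P ∂ν ≤ C) :
    ∫ ω, (∫ s, Y s ω ∂ν) ^ 2 ∂P ≤ C * ν.real Set.univ := by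
  have hswap : Measurable fun z : Ω × S => Y z.2 z.1 := hY.comp measurable_swap
  have hI : Measurable fun ω => ∫ s, Y s ω ∂ν :=
    hswap.stronglyMeasurable.integral_prod_right.measurable
  have hIK (ω : Ω) : |∫ s, Y s ω ∂ν| ≤ K * ν.real Set.univ :=
    norm_integral_le_of_norm_le_const (f := fun s => Y s ω) (ae_of_all _ fun s => hK s ω)
  have hIY : Integrable (Function.uncurry fun ω u => (∫ s, Y s ω ∂ν) * Y u ω) (P.prod ν) :=
    ((integrable_of_forall_abs_le hI.aestronglyMeasurable hIK).comp_fst ν).mul_bdd (c := K)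
      hswap.aestronglyMeasurable (ae_of_all _ fun z => hK z.2 z.1)
  have hYY (u : S) : Integrable (Function.uncurry fun ω s => Y s ω * Y u ω) (P.prod ν) :=
    (integrable_of_forall_abs_le hswap.aestronglyMeasurable fun z => hK z.2 z.1).mul_bdd (c := K)
      (hY.comp (measurable_const.prodMk measurable_fst)).aestronglyMeasurable
      (ae_of_all _ fun z => hK u z.1)
  have hinner (u : S) : ∫ ω, (∫ s, Y s ω ∂ν) * Y u ω ∂P ≤ C := by
    simp_rw [← integral_mul_const]
    exact (integral_integral_swap (hYY u)).trans_le (hC u)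
  calc ∫ ω, (∫ s, Y s ω ∂ν) ^ 2 ∂P = ∫ ω, ∫ u, (∫ s, Y s ω ∂ν) * Y u ω ∂ν ∂P := by
        simp_rw [sq, integral_const_mul]
    _ = ∫ u, ∫ ω, (∫ s, Y s ω ∂ν) * Y u ω ∂P ∂ν := integral_integral_swap hIY
    _ ≤ ∫ _, C ∂ν := integral_mono hIY.integral_prod_right (integrable_const C) hinner
    _ = C * ν.real Set.univ := by rw [integral_const, smul_eq_mul, mul_comm]

theorem integral_mul_eq_mul_integral_of_aestronglyMeasurable_bot {Ω : Type*} [MeasurableSpace Ω]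
    {P : Measure Ω} [IsProbabilityMeasure P] {F : Ω → ℝ} (hF : AEStronglyMeasurable[⊥] F P)
    (G : Ω → ℝ) : ∫ ω, F ω * G ω ∂P = (∫ ω, F ω ∂P) * ∫ ω, G ω ∂P := by
  obtain ⟨F', hF', hFF'⟩ := hF
  have := P.nonempty_of_neZero
  obtain ⟨c, rfl⟩ := stronglyMeasurable_bot_iff.1 hF'
  rw [integral_congr_ae hFF', integral_congr_ae (hFF'.mono fun ω hω => congrArg (· * G ω) hω),
    integral_const_mul, integral_const, probReal_univ, one_smul]

theorem sum_range_two_mul {G : Type*} [AddCommMonoid G] (a : ℕ → G) (n : ℕ) :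
    ∑ i ∈ Finset.range (2 * n), a i
      = ∑ j ∈ Finset.range n, a (2 * j) + ∑ j ∈ Finset.range n, a (2 * j + 1) := by
  induction n with
  | zero => simp
  | succ n ih =>
    rw [mul_add_one, Finset.sum_range_succ, Finset.sum_range_succ, ih, Finset.sum_range_succ,
      Finset.sum_range_succ]
    abel

theorem mul_half_le_mul_card_filter_of_le_sum {ι : Type*} (s : Finset ι) {a : ι → ℝ} {K R : ℝ}
    (hK : ∀ i, a i ≤ K) (hR : 0 ≤ R) (h : s.card * R ≤ ∑ i ∈ s, a i) :
    s.card * (R / 2) ≤ K * {i ∈ s | R / 2 ≤ a i}.card := by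
  have hle : ∑ i ∈ s, a i ≤ ∑ i ∈ s, (R / 2 + if R / 2 ≤ a i then K else 0) :=
    Finset.sum_le_sum fun i _ => by
      split_ifs with hi
      · linarith [hK i]
      · linarith
  rw [Finset.sum_add_distrib, Finset.sum_const, nsmul_eq_mul, ← Finset.sum_filter,
    Finset.sum_const, nsmul_eq_mul] at hle
  linarith

theorem integral_bind {S T : Type*} [MeasurableSpace S] [MeasurableSpace T] {ν : Measure S}
    [SFinite ν] {κ : Kernel S T} [IsSFiniteKernel κ] {f : T → ℝ} (hf : Integrable f (ν.bind κ)) :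
    ∫ y, f y ∂(ν.bind κ) = ∫ x, ∫ y, f y ∂(κ x) ∂ν :=
  Kernel.integral_comp (κ := Kernel.const Unit ν) (a := ()) hf

namespace MarkovProcess

variable {E Ω : Type*} [MeasurableSpace E] [MeasurableSpace Ω]

instance (M : MarkovProcess E Ω) : IsMarkovKernel M.Pr := M.isMarkovKernel

theorem measurable_X_apply (M : MarkovProcess E Ω) (t : ℝ≥0) : Measurable (M.X t) :=
  M.measurable_X.comp measurable_prodMk_left

instance (M : MarkovProcess E Ω) (t : ℝ≥0) : IsMarkovKernel (M.transition t) :=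
  Kernel.IsMarkovKernel.map _ (M.measurable_X_apply t)

instance (M : MarkovProcess E Ω) (μ : Measure E) [IsProbabilityMeasure μ] :
    IsProbabilityMeasure (M.law μ) := by
  unfold law; infer_instance

/-- The σ-algebra `σ(X_u, u ≤ s)` of the past of time `s`, in the form used by the field
`MarkovProcess.markov`. -/
@[reducible]
def past (M : MarkovProcess E Ω) (s : ℝ≥0) : MeasurableSpace Ω :=
  ⨆ u : Set.Iic s, MeasurableSpace.comap (M.X u) inferInstance

/-- The σ-algebra `σ(X_u, u ≥ s)` of the future of time `s`. -/
@[reducible]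
def future (M : MarkovProcess E Ω) (s : ℝ≥0) : MeasurableSpace Ω :=
  ⨆ u ∈ Set.Ici s, MeasurableSpace.comap (M.X u) inferInstance

variable (M : MarkovProcess E Ω)

theorem past_le (s : ℝ≥0) : M.past s ≤ (inferInstance : MeasurableSpace Ω) :=
  iSup_le fun u => (M.measurable_X_apply u).comap_le

theorem future_le (s : ℝ≥0) : M.future s ≤ (inferInstance : MeasurableSpace Ω) :=
  iSup₂_le fun u _ => (M.measurable_X_apply u).comap_le

theorem comap_X_le_past {u s : ℝ≥0} (h : u ≤ s) :
    MeasurableSpace.comap (M.X u) inferInstance ≤ M.past s :=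
  le_iSup_of_le (⟨u, h⟩ : Set.Iic s) le_rfl

theorem comap_X_le_future {s u : ℝ≥0} (h : s ≤ u) :
    MeasurableSpace.comap (M.X u) inferInstance ≤ M.future s :=
  le_iSup₂_of_le u h le_rfl

theorem past_mono : Monotone M.past := fun _ _ h =>
  iSup_le fun u => M.comap_X_le_past (u.2.trans h)

theorem measurable_X_past {u s : ℝ≥0} (h : u ≤ s) : Measurable[M.past s] (M.X u) :=
  Measurable.of_comap_le (M.comap_X_le_past h)

theorem measurable_X_future {s u : ℝ≥0} (h : s ≤ u) : Measurable[M.future s] (M.X u) :=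
  Measurable.of_comap_le (M.comap_X_le_future h)

variable {μ : Measure E}

/-! ### The Markov property under an invariant law -/

theorem law_map_X (hμ : M.IsInvariant μ) (s : ℝ≥0) : (M.law μ).map (M.X s) = μ := by
  rw [law, Measure.map_comp μ M.Pr (M.measurable_X_apply s)]
  exact hμ s

theorem integral_law_X (hμ : M.IsInvariant μ) (s : ℝ≥0) {f : E → ℝ} (hf : Measurable f) :
    ∫ ω, f (M.X s ω) ∂(M.law μ) = ∫ x, f x ∂μ := by
  rw [← integral_map (M.measurable_X_apply s).aemeasurable hf.aestronglyMeasurable,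
    M.law_map_X hμ]

theorem measurable_semigroup (t : ℝ≥0) {f : E → ℝ} (hf : Measurable f) :
    Measurable (M.semigroup t f) :=
  (hf.stronglyMeasurable.integral_kernel (κ := M.transition t)).measurable

theorem abs_semigroup_le (t : ℝ≥0) {f : E → ℝ} {C : ℝ} (hC : ∀ x, |f x| ≤ C) (x : E) :
    |M.semigroup t f x| ≤ C :=
  abs_integral_le_of_forall_abs_le hC

theorem law_inter_preimage (s t : ℝ≥0) {A : Set Ω} (hA : MeasurableSet[M.past s] A) {B : Set E}
    (hB : MeasurableSet B) :
    M.law μ (A ∩ M.X (s + t) ⁻¹' B) = ∫⁻ ω in A, M.transition t (M.X s ω) B ∂(M.law μ) := by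
  have hA' : MeasurableSet A := M.past_le s A hA
  have htrans : Measurable fun ω => M.transition t (M.X s ω) B :=
    (Kernel.measurable_coe _ hB).comp (M.measurable_X_apply s)
  rw [← lintegral_indicator hA', law, Measure.lintegral_bind M.Pr.aemeasurable
      (htrans.indicator hA').aemeasurable,
    Measure.bind_apply (hA'.inter (M.measurable_X_apply _ hB)) M.Pr.aemeasurable]
  refine lintegral_congr fun x => ?_
  simp_rw [lintegral_indicator hA', M.markov x s t A hA B hB, transition,
    Kernel.map_apply' _ (M.measurable_X_apply t) _ hB]

theorem restrict_law_map_X_add (s t : ℝ≥0) {A : Set Ω} (hA : MeasurableSet[M.past s] A) :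
    ((M.law μ).restrict A).map (M.X (s + t))
      = (((M.law μ).restrict A).map (M.X s)).bind (M.transition t) := by
  ext B hB
  rw [Measure.map_apply (M.measurable_X_apply _) hB,
    Measure.restrict_apply (M.measurable_X_apply _ hB), Set.inter_comm,
    M.law_inter_preimage s t hA hB, Measure.bind_apply hB (Kernel.aemeasurable _),
    lintegral_map (Kernel.measurable_coe _ hB) (M.measurable_X_apply _)]

variable [IsProbabilityMeasure μ]

theorem condExp_past_comp_X (s t : ℝ≥0) {f : E → ℝ} (hf : Measurable f) {C : ℝ}
    (hC : ∀ x, |f x| ≤ C) :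
    (M.law μ)[fun ω => f (M.X (s + t) ω)|M.past s]
      =ᵐ[M.law μ] fun ω => M.semigroup t f (M.X s ω) := by
  have hPf : Measurable (M.semigroup t f) := M.measurable_semigroup t hf
  have hPfint : Integrable (fun ω => M.semigroup t f (M.X s ω)) (M.law μ) :=
    integrable_of_forall_abs_le (hPf.comp (M.measurable_X_apply s)).aestronglyMeasurable
      fun _ => M.abs_semigroup_le t hC _
  refine (ae_eq_condExp_of_forall_setIntegral_eq (M.past_le s) ?_ (fun _ _ _ => hPfint.integrableOn)
    (fun A hA _ => ?_) (hPf.comp (M.measurable_X_past le_rfl)).aestronglyMeasurable).symm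
  · exact integrable_of_forall_abs_le
      (hf.comp (M.measurable_X_apply _)).aestronglyMeasurable fun _ => hC _
  · have hbind := M.restrict_law_map_X_add (μ := μ) s t hA
    rw [← integral_map (M.measurable_X_apply _).aemeasurable hf.aestronglyMeasurable, hbind,
      ← integral_map (M.measurable_X_apply s).aemeasurable hPf.aestronglyMeasurable,
      integral_bind (hbind ▸ integrable_of_forall_abs_le hf.aestronglyMeasurable hC)]
    rfl

theorem exists_condExp_past_prod_ae_eq (I : Finset ℝ≥0) {φ : ℝ≥0 → E → ℝ}
    (hφ : ∀ i, Measurable (φ i)) (hφ1 : ∀ i x, |φ i x| ≤ 1) {s : ℝ≥0} (hI : ∀ i ∈ I, s ≤ i) :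
    ∃ g : E → ℝ, Measurable g ∧ (∀ x, |g x| ≤ 1) ∧
      (M.law μ)[fun ω => ∏ i ∈ I, φ i (M.X i ω)|M.past s] =ᵐ[M.law μ] fun ω => g (M.X s ω) := by
  induction I using Finset.induction_on_min generalizing s with
  | empty =>
    refine ⟨fun _ => 1, measurable_const, by simp, ?_⟩
    simp only [Finset.prod_empty, condExp_const (M.past_le s)]
    rfl
  | insert a I ha ih =>
    obtain ⟨g, hg, hg1, hgI⟩ := ih fun i hi => (ha i hi).le
    have hsa : s ≤ a := hI a (Finset.mem_insert_self a I)
    have hφg (x : E) : |φ a x * g x| ≤ 1 := by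
      rw [abs_mul]
      exact mul_le_one₀ (hφ1 a x) (abs_nonneg _) (hg1 x)
    have hφgm : Measurable fun x => φ a x * g x := (hφ a).mul hg
    refine ⟨M.semigroup (a - s) fun x => φ a x * g x, M.measurable_semigroup _ hφgm,
      M.abs_semigroup_le _ hφg, ?_⟩
    have hprod (J : Finset ℝ≥0) :
        Integrable (fun ω => ∏ i ∈ J, φ i (M.X i ω)) (M.law μ) := by
      refine integrable_of_forall_abs_le (C := 1) (Finset.measurable_prod _ fun i _ =>
        (hφ i).comp (M.measurable_X_apply i)).aestronglyMeasurable fun ω => ?_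
      rw [Finset.abs_prod]
      exact Finset.prod_le_one (fun _ _ => abs_nonneg _) fun i _ => hφ1 i _
    have hinsert : (fun ω => ∏ i ∈ insert a I, φ i (M.X i ω))
        = (fun ω => φ a (M.X a ω)) * fun ω => ∏ i ∈ I, φ i (M.X i ω) := funext fun ω =>
      Finset.prod_insert fun haI => (ha a haI).false
    have hpast_a : (M.law μ)[fun ω => ∏ i ∈ insert a I, φ i (M.X i ω)|M.past a]
        =ᵐ[M.law μ] fun ω => φ a (M.X a ω) * g (M.X a ω) := by
      rw [hinsert]
      refine (condExp_mul_of_aestronglyMeasurable_left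
        ((hφ a).comp (M.measurable_X_past le_rfl)).aestronglyMeasurable
        (hinsert ▸ hprod _) (hprod I)).trans ?_
      filter_upwards [hgI] with ω hω
      rw [Pi.mul_apply, hω]
      rfl
    have hXa := M.condExp_past_comp_X (μ := μ) s (a - s) hφgm hφg
    rw [add_tsub_cancel_of_le hsa] at hXa
    exact (condExp_condExp_of_le (M.past_mono hsa) (M.past_le a)).symm.trans
      ((condExp_congr_ae hpast_a).trans hXa)

theorem setIntegral_future_eq_zero {s : ℝ≥0} {H : Ω → ℝ}
    (hH : AEStronglyMeasurable[M.past s] H (M.law μ)) (hHint : Integrable H (M.law μ))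
    (horth : ∀ g : E → ℝ, Measurable g → (∀ x, |g x| ≤ 1) →
      ∫ ω, g (M.X s ω) * H ω ∂(M.law μ) = 0) {B : Set Ω} (hB : MeasurableSet[M.future s] B) :
    ∫ ω in B, H ω ∂(M.law μ) = 0 := by
  refine setIntegral_eq_zero_of_isPiSystem (M.future_le s) hHint
    (generateFrom_piiUnionInter_measurableSet _ _).symm
    (isPiSystem_piiUnionInter _ (fun u => @MeasurableSpace.isPiSystem_measurableSet _
      (MeasurableSpace.comap (M.X u) inferInstance)) _)
    (by simpa using horth (fun _ => 1) measurable_const (by simp)) ?_ hB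
  rintro _ ⟨I, hI, f, hf, rfl⟩
  have hcyl : ∀ i, ∃ A : Set E, MeasurableSet A ∧ (i ∈ I → M.X i ⁻¹' A = f i) := fun i => by
    by_cases hi : i ∈ I
    · obtain ⟨A, hA, hAf⟩ := hf i hi
      exact ⟨A, hA, fun _ => hAf⟩
    · exact ⟨∅, .empty, fun h => absurd h hi⟩
  choose A hA hAf using hcyl
  obtain ⟨g, hg, hg1, hgcond⟩ := M.exists_condExp_past_prod_ae_eq (μ := μ) I
    (φ := fun i => (A i).indicator 1) (fun i => measurable_one.indicator (hA i))
    (fun i x => by by_cases hx : x ∈ A i <;> simp [hx]) (fun i hi => hI hi)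
  set Φ : Ω → ℝ := fun ω => ∏ i ∈ I, (A i).indicator 1 (M.X i ω)
  have hB' : MeasurableSet (⋂ i ∈ I, f i) := Finset.measurableSet_biInter I fun i hi =>
    hAf i hi ▸ M.measurable_X_apply i (hA i)
  have hΦ : Φ = (⋂ i ∈ I, f i).indicator 1 := funext fun ω => by
    classical
    simp only [Φ, Set.indicator_apply, Set.mem_iInter, Pi.one_apply, Finset.prod_boole]
    exact if_congr (forall₂_congr fun i hi => hAf i hi ▸ Iff.rfl) rfl rfl
  have hΦm : AEStronglyMeasurable Φ (M.law μ) :=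
    hΦ ▸ (measurable_one.indicator hB').aestronglyMeasurable
  have hΦ1 (ω : Ω) : |Φ ω| ≤ 1 := by
    by_cases hω : ω ∈ ⋂ i ∈ I, f i <;>
      simp only [hΦ, hω, Set.indicator_of_mem, Set.indicator_of_notMem, not_false_eq_true,
        Pi.one_apply, abs_one, abs_zero, le_refl, zero_le_one]
  have hΦH : Integrable (Φ * H) (M.law μ) := hHint.bdd_mul hΦm (ae_of_all _ hΦ1)
  have hΦint : Integrable Φ (M.law μ) := integrable_of_forall_abs_le hΦm hΦ1
  calc ∫ ω in ⋂ i ∈ I, f i, H ω ∂(M.law μ) = ∫ ω, Φ ω * H ω ∂(M.law μ) := by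
        rw [← integral_indicator hB', hΦ]
        exact integral_congr_ae (ae_of_all _ fun ω => by
          by_cases hω : ω ∈ ⋂ i ∈ I, f i <;> simp only [hω, Set.indicator_of_mem,
            Set.indicator_of_notMem, not_false_eq_true, Pi.one_apply, one_mul, zero_mul])
    _ = ∫ ω, (M.law μ)[Φ|M.past s] ω * H ω ∂(M.law μ) :=
        (integral_condExp_mul (M.past_le s) hΦint hH hΦH).symm
    _ = ∫ ω, g (M.X s ω) * H ω ∂(M.law μ) :=
        integral_congr_ae (hgcond.mono fun ω hω => by simp only [hω])
    _ = 0 := horth g hg hg1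

theorem integral_mul_eq_integral_condExp_comap_X_mul {s : ℝ≥0} {F G : Ω → ℝ} {L D : ℝ}
    (hF : AEStronglyMeasurable[M.past s] F (M.law μ)) (hL : ∀ ω, |F ω| ≤ L)
    (hG : AEStronglyMeasurable[M.future s] G (M.law μ)) (hD : ∀ ω, |G ω| ≤ D) :
    ∫ ω, F ω * G ω ∂(M.law μ)
      = ∫ ω, (M.law μ)[F|MeasurableSpace.comap (M.X s) inferInstance] ω * G ω ∂(M.law μ) := by
  set H : Ω → ℝ := fun ω => F ω - (M.law μ)[F|MeasurableSpace.comap (M.X s) inferInstance] ω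
    with hH
  have hFint : Integrable F (M.law μ) := integrable_of_forall_abs_le (hF.mono (M.past_le s)) hL
  have hGm : AEStronglyMeasurable G (M.law μ) := hG.mono (M.future_le s)
  have hHint : Integrable H (M.law μ) := hFint.sub integrable_condExp
  have hHm : AEStronglyMeasurable[M.past s] H (M.law μ) := hF.sub
    (stronglyMeasurable_condExp.mono (M.comap_X_le_past le_rfl)).aestronglyMeasurable
  have hcond : (M.law μ)[H|M.future s] =ᵐ[M.law μ] 0 := by
    refine (ae_eq_condExp_of_forall_setIntegral_eq (M.future_le s) hHint
      (fun _ _ _ => integrableOn_zero) (fun B hB _ => ?_) aestronglyMeasurable_zero).symm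
    rw [M.setIntegral_future_eq_zero hHm hHint (fun g hg hg1 => ?_) hB]
    · simp
    · have hgX : Measurable[MeasurableSpace.comap (M.X s) inferInstance] fun ω => g (M.X s ω) :=
        hg.comp (comap_measurable _)
      simp_rw [mul_comm (g _)]
      exact integral_sub_condExp_mul_eq_zero (M.measurable_X_apply s).comap_le hFint
        hgX.aestronglyMeasurable (hFint.mul_bdd (c := 1)
          (hg.comp (M.measurable_X_apply s)).aestronglyMeasurable (ae_of_all _ fun _ => hg1 _))
  have hHG : ∫ ω, H ω * G ω ∂(M.law μ) = 0 := by
    rw [← integral_condExp_mul (M.future_le s) hHint hG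
      (hHint.mul_bdd hGm (ae_of_all _ hD))]
    exact integral_eq_zero_of_ae (hcond.mono fun ω hω => by simp only [hω, Pi.zero_apply, zero_mul])
  simp_rw [hH, sub_mul] at hHG
  rwa [integral_sub (hFint.mul_bdd hGm (ae_of_all _ hD))
    (integrable_condExp.mul_bdd hGm (ae_of_all _ hD)), sub_eq_zero] at hHG

theorem integral_mul_eq_integral_mul_condExp_comap_X {s : ℝ≥0} {F G : Ω → ℝ} {L D : ℝ}
    (hF : AEStronglyMeasurable[M.past s] F (M.law μ)) (hL : ∀ ω, |F ω| ≤ L)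
    (hG : AEStronglyMeasurable[M.future s] G (M.law μ)) (hD : ∀ ω, |G ω| ≤ D) :
    ∫ ω, F ω * G ω ∂(M.law μ)
      = ∫ ω, F ω * (M.law μ)[G|MeasurableSpace.comap (M.X s) inferInstance] ω ∂(M.law μ) := by
  have hm := (M.measurable_X_apply s).comap_le
  have hFint : Integrable F (M.law μ) := integrable_of_forall_abs_le (hF.mono (M.past_le s)) hL
  have hGint : Integrable G (M.law μ) := integrable_of_forall_abs_le (hG.mono (M.future_le s)) hD
  rw [M.integral_mul_eq_integral_condExp_comap_X_mul hF hL hG hD,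
    ← integral_condExp_mul hm hFint stronglyMeasurable_condExp.aestronglyMeasurable
      (hFint.mul_bdd integrable_condExp.aestronglyMeasurable
        (ae_bdd_abs_condExp_of_ae_bdd_abs (ae_of_all _ hD)))]
  simp_rw [mul_comm ((M.law μ)[F|_] _)]
  exact (integral_condExp_mul hm hGint stronglyMeasurable_condExp.aestronglyMeasurable
    (hGint.mul_bdd integrable_condExp.aestronglyMeasurable
      (ae_bdd_abs_condExp_of_ae_bdd_abs (ae_of_all _ hL)))).symm

/-! ### From the decay property to mixing -/

theorem transition_add (s t : ℝ≥0) (x : E) :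
    M.transition (s + t) x = (M.transition s x).bind (M.transition t) := by
  have h := M.restrict_law_map_X_add (μ := Measure.dirac x) s t MeasurableSet.univ
  rw [Measure.restrict_univ, law, Measure.dirac_bind M.Pr.measurable] at h
  simpa only [transition, Kernel.map_apply _ (M.measurable_X_apply _)] using h

theorem semigroup_add (s t : ℝ≥0) {f : E → ℝ} (hf : Measurable f) {C : ℝ} (hC : ∀ x, |f x| ≤ C)
    (x : E) : M.semigroup (s + t) f x = M.semigroup s (M.semigroup t f) x := by
  have h := M.transition_add s t x
  rw [semigroup, h,
    integral_bind (h ▸ integrable_of_forall_abs_le hf.aestronglyMeasurable hC)]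
  rfl

theorem integral_semigroup (hμ : M.IsInvariant μ) (t : ℝ≥0) {f : E → ℝ} (hf : Measurable f) {C : ℝ}
    (hC : ∀ x, |f x| ≤ C) : ∫ x, M.semigroup t f x ∂μ = ∫ x, f x ∂μ := by
  have hint : Integrable f μ := integrable_of_forall_abs_le hf.aestronglyMeasurable hC
  have h := integral_bind (ν := μ) (κ := M.transition t) (f := f) ((hμ t).symm ▸ hint)
  rwa [hμ t, eq_comm] at h

theorem integral_compProd_transition (t : ℝ≥0) {f g : E → ℝ} (hf : Measurable f)
    (hg : Measurable g) {C D : ℝ} (hC : ∀ x, |f x| ≤ C) (hD : ∀ x, |g x| ≤ D) :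
    ∫ z, f z.1 * g z.2 ∂(μ ⊗ₘ M.transition t) = ∫ x, f x * M.semigroup t g x ∂μ := by
  have hint : Integrable (fun z : E × E => f z.1 * g z.2) (μ ⊗ₘ M.transition t) :=
    (integrable_of_forall_abs_le (hf.comp measurable_fst).aestronglyMeasurable
      fun z => hC z.1).mul_bdd (hg.comp measurable_snd).aestronglyMeasurable
        (ae_of_all _ fun z => hD z.2)
  rw [Measure.integral_compProd hint]
  exact integral_congr_ae (ae_of_all _ fun x => integral_const_mul (f x) g)

variable {M}

omit [IsProbabilityMeasure μ] in
theorem IsSymmetric.isInvariant (hs : M.IsSymmetric μ) : M.IsInvariant μ :=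
  fun t => (hs t).invariant

theorem IsSymmetric.integral_mul_semigroup_comm (hs : M.IsSymmetric μ) (t : ℝ≥0) {f g : E → ℝ}
    (hf : Measurable f) (hg : Measurable g) {C D : ℝ} (hC : ∀ x, |f x| ≤ C)
    (hD : ∀ x, |g x| ≤ D) :
    ∫ x, f x * M.semigroup t g x ∂μ = ∫ x, M.semigroup t f x * g x ∂μ := by
  have hswap : (μ ⊗ₘ M.transition t).map Prod.swap = μ ⊗ₘ M.transition t := by
    have : IsProbabilityMeasure ((μ ⊗ₘ M.transition t).map Prod.swap) :=
      Measure.isProbabilityMeasure_map measurable_swap.aemeasurable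
    refine Measure.ext_prod fun {A B} hA hB => ?_
    rw [Measure.map_apply measurable_swap (hA.prod hB), Set.preimage_swap_prod,
      Measure.compProd_apply_prod hA hB, Measure.compProd_apply_prod hB hA, hs t hB hA]
  simp_rw [mul_comm (M.semigroup t f _)]
  rw [← M.integral_compProd_transition t hf hg hC hD,
    ← M.integral_compProd_transition t hg hf hD hC]
  nth_rw 2 [← hswap]
  refine Eq.trans ?_ (integral_map measurable_swap.aemeasurable
    ((hg.comp measurable_fst).mul (hf.comp measurable_snd)).aestronglyMeasurable).symm
  exact integral_congr_ae (ae_of_all _ fun z => mul_comm _ _)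

theorem IsSymmetric.covariance_semigroup_add_self (hs : M.IsSymmetric μ) (r : ℝ≥0) {f g : E → ℝ}
    (hf : Measurable f) (hg : Measurable g) {C D : ℝ} (hC : ∀ x, |f x| ≤ C)
    (hD : ∀ x, |g x| ≤ D) :
    cov[f, M.semigroup (r + r) g; μ] = cov[M.semigroup r f, M.semigroup r g; μ] := by
  have hPf := M.measurable_semigroup r hf
  have hPg := M.measurable_semigroup r hg
  have hPfC := M.abs_semigroup_le r hC
  have hPgD := M.abs_semigroup_le r hD
  rw [funext (M.semigroup_add r r hg hD), covariance_eq_sub (memLp_two_of_forall_abs_le hf hC)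
    (memLp_two_of_forall_abs_le (M.measurable_semigroup r hPg) (M.abs_semigroup_le r hPgD)),
    covariance_eq_sub (memLp_two_of_forall_abs_le hPf hPfC) (memLp_two_of_forall_abs_le hPg hPgD),
    M.integral_semigroup hs.isInvariant r hPg hPgD, M.integral_semigroup hs.isInvariant r hf hC]
  congr 1
  exact hs.integral_mul_semigroup_comm r hf hPg hC hPgD

theorem Decay.sqrt_variance_semigroup_le {η : ℝ≥0 → ℝ} (h : M.Decay μ η) {f : E → ℝ}
    (hf : Measurable f) {K : ℝ} (hK : ∀ x, |f x| ≤ K) (s : ℝ≥0) :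
    √Var[M.semigroup s f; μ] ≤ √(η s) * (2 * K) := by
  have hosc (x : E) : |f x - ∫ y, f y ∂μ| ≤ 2 * K :=
    (abs_sub _ _).trans (by linarith [hK x, abs_integral_le_of_forall_abs_le (P := μ) hK])
  have : Nonempty E := μ.nonempty_of_neZero
  calc √Var[M.semigroup s f; μ] ≤ √(η s * (⨆ x, |f x - ∫ y, f y ∂μ|) ^ 2) :=
        Real.sqrt_le_sqrt (h.2 f hf ⟨K, hK⟩ s)
    _ = √(η s) * ⨆ x, |f x - ∫ y, f y ∂μ| := by
        rw [Real.sqrt_mul' _ (sq_nonneg _), Real.sqrt_sq (Real.iSup_nonneg fun _ => abs_nonneg _)]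
    _ ≤ √(η s) * (2 * K) := by gcongr; exact ciSup_le hosc

/-- `α` is a rate of convergence to equilibrium from `L^∞(μ)` to `L¹(μ)`. The factor `4` makes it
comparable with an `α`-mixing coefficient. -/
def IsMixing (M : MarkovProcess E Ω) (μ : Measure E) (α : ℝ≥0 → ℝ) : Prop :=
  ∀ ⦃f : E → ℝ⦄ ⦃K : ℝ⦄, Measurable f → (∀ x, |f x| ≤ K) → ∀ s,
    ∫ x, |M.semigroup s f x - ∫ y, f y ∂μ| ∂μ ≤ 4 * α s * K

theorem DecayWithRate.isMixing (hμ : M.IsInvariant μ) {α : ℝ≥0 → ℝ} (h : M.DecayWithRate μ α)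
    (hα : ∀ s, 0 ≤ α s) : M.IsMixing μ α := by
  intro f K hf hK s
  obtain ⟨η, hη, hrate⟩ := h
  obtain ⟨x₀⟩ : Nonempty E := μ.nonempty_of_neZero
  have hK0 : 0 ≤ K := (abs_nonneg _).trans (hK x₀)
  have hPf := M.measurable_semigroup s hf
  have hPfK := M.abs_semigroup_le s hK
  obtain ⟨σ, hσ, hσ1, hcov⟩ := exists_integral_abs_sub_integral_eq_covariance (P := μ) hPf hPfK
  rw [M.integral_semigroup hμ s hf hK] at hcov
  rw [hcov]
  obtain hα_eq | ⟨hs, hα_eq⟩ := hrate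
  · have hVarσ : √Var[σ; μ] ≤ 1 := Real.sqrt_le_one.2 <| by
      have := variance_le_sq_of_bounded (ae_of_all μ fun x => abs_le.1 (hσ1 x)) hσ.aemeasurable
      norm_num at this ⊢
      exact this
    calc cov[σ, M.semigroup s f; μ] ≤ √Var[σ; μ] * √Var[M.semigroup s f; μ] :=
          covariance_le_sqrt_variance_mul_sqrt_variance (memLp_two_of_forall_abs_le hσ hσ1)
            (memLp_two_of_forall_abs_le hPf hPfK)
      _ ≤ 1 * (√(η s) * (2 * K)) := by gcongr; exact hη.sqrt_variance_semigroup_le hf hK s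
      _ ≤ 4 * α s * K := by
          rw [← hα_eq]
          linarith [mul_nonneg (hα s) hK0]
  · rw [← add_halves s, hs.covariance_semigroup_add_self _ hσ hf hσ1 hK]
    calc cov[M.semigroup (s / 2) σ, M.semigroup (s / 2) f; μ]
        ≤ √Var[M.semigroup (s / 2) σ; μ] * √Var[M.semigroup (s / 2) f; μ] :=
          covariance_le_sqrt_variance_mul_sqrt_variance
            (memLp_two_of_forall_abs_le (M.measurable_semigroup _ hσ) (M.abs_semigroup_le _ hσ1))
            (memLp_two_of_forall_abs_le (M.measurable_semigroup _ hf) (M.abs_semigroup_le _ hK))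
      _ ≤ √(η (s / 2)) * (2 * 1) * (√(η (s / 2)) * (2 * K)) := by
          gcongr
          exacts [hη.sqrt_variance_semigroup_le hσ hσ1 _, hη.sqrt_variance_semigroup_le hf hK _]
      _ = 4 * α (s / 2 + s / 2) * K := by
          rw [add_halves, hα_eq]
          linear_combination 4 * K * Real.mul_self_sqrt (hα_eq s ▸ hα s)

theorem IsMixing.abs_integral_mul_comp_X_sub_le {α : ℝ≥0 → ℝ} (h : M.IsMixing μ α)
    (hμ : M.IsInvariant μ) (u l : ℝ≥0) {F : Ω → ℝ} {g : E → ℝ} {L D : ℝ}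
    (hF : AEStronglyMeasurable[M.past u] F (M.law μ)) (hL : ∀ ω, |F ω| ≤ L)
    (hg : Measurable g) (hD : ∀ x, |g x| ≤ D) :
    |∫ ω, F ω * g (M.X (u + l) ω) ∂(M.law μ) - (∫ ω, F ω ∂(M.law μ)) * ∫ x, g x ∂μ|
      ≤ 4 * α l * L * D := by
  obtain ⟨ω₀⟩ : Nonempty Ω := (M.law μ).nonempty_of_neZero
  have hL0 : 0 ≤ L := (abs_nonneg _).trans (hL ω₀)
  have hPg : Measurable (M.semigroup l g) := M.measurable_semigroup l hg
  have hFm : AEStronglyMeasurable F (M.law μ) := hF.mono (M.past_le u)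
  have hFint : Integrable F (M.law μ) := integrable_of_forall_abs_le hFm hL
  have hgint : Integrable (fun ω => g (M.X (u + l) ω)) (M.law μ) :=
    integrable_of_forall_abs_le (hg.comp (M.measurable_X_apply _)).aestronglyMeasurable
      fun _ => hD _
  have hPgint : Integrable (fun ω => M.semigroup l g (M.X u ω)) (M.law μ) :=
    integrable_of_forall_abs_le (hPg.comp (M.measurable_X_apply u)).aestronglyMeasurable
      fun _ => M.abs_semigroup_le l hD _
  have hmarkov : ∫ ω, F ω * g (M.X (u + l) ω) ∂(M.law μ)
      = ∫ ω, F ω * M.semigroup l g (M.X u ω) ∂(M.law μ) := by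
    simp_rw [mul_comm (F _)]
    rw [← integral_condExp_mul (M.past_le u) hgint hF (hgint.mul_bdd hFm (ae_of_all _ hL))]
    exact integral_congr_ae ((M.condExp_past_comp_X u l hg hD).mono
      fun ω hω => congrArg (· * F ω) hω)
  calc |∫ ω, F ω * g (M.X (u + l) ω) ∂(M.law μ) - (∫ ω, F ω ∂(M.law μ)) * ∫ x, g x ∂μ|
      = |∫ ω, F ω * (M.semigroup l g (M.X u ω) - ∫ x, g x ∂μ) ∂(M.law μ)| := by
        simp_rw [hmarkov, mul_sub]
        rw [integral_sub (hPgint.bdd_mul hFm (ae_of_all _ hL)) (hFint.mul_const _),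
          integral_mul_const]
    _ ≤ ∫ ω, L * |M.semigroup l g (M.X u ω) - ∫ x, g x ∂μ| ∂(M.law μ) := by
        rw [← Real.norm_eq_abs]
        refine norm_integral_le_of_norm_le ((hPgint.sub (integrable_const _)).abs.const_mul L)
          (ae_of_all _ fun ω => ?_)
        rw [norm_mul]
        exact mul_le_mul_of_nonneg_right (hL ω) (abs_nonneg _)
    _ = L * ∫ x, |M.semigroup l g x - ∫ y, g y ∂μ| ∂μ := by
        rw [integral_const_mul, M.integral_law_X hμ u (f := fun x => |M.semigroup l g x - _|)
          (hPg.sub measurable_const).abs]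
    _ ≤ L * (4 * α l * D) := by gcongr; exact h hg hD l
    _ = 4 * α l * L * D := by ring

theorem IsMixing.abs_integral_mul_sub_le {α : ℝ≥0 → ℝ} (h : M.IsMixing μ α)
    (hμ : M.IsInvariant μ) {u l : ℝ≥0} {F G : Ω → ℝ} {L D : ℝ}
    (hF : AEStronglyMeasurable[M.past u] F (M.law μ)) (hL : ∀ ω, |F ω| ≤ L)
    (hG : AEStronglyMeasurable[M.future (u + l)] G (M.law μ)) (hD : ∀ ω, |G ω| ≤ D) :
    |∫ ω, F ω * G ω ∂(M.law μ) - (∫ ω, F ω ∂(M.law μ)) * ∫ ω, G ω ∂(M.law μ)|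
      ≤ 4 * α l * L * D := by
  obtain ⟨g, hg, hgD, hGg⟩ := exists_condExp_comap_ae_eq (P := M.law μ) (X := M.X (u + l)) hD
  have hFG : ∫ ω, F ω * G ω ∂(M.law μ) = ∫ ω, F ω * g (M.X (u + l) ω) ∂(M.law μ) := by
    rw [M.integral_mul_eq_integral_mul_condExp_comap_X
      (hF.mono (M.past_mono (self_le_add_right u l))) hL hG hD]
    exact integral_congr_ae (hGg.mono fun ω hω => congrArg (F ω * ·) hω)
  have hmeanG : ∫ ω, G ω ∂(M.law μ) = ∫ x, g x ∂μ := by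
    rw [← integral_condExp (M.measurable_X_apply (u + l)).comap_le, integral_congr_ae hGg,
      M.integral_law_X hμ _ hg]
  rw [hFG, hmeanG]
  exact h.abs_integral_mul_comp_X_sub_le hμ u l hF hL hg hgD

theorem IsMixing.abs_integral_comp_X_mul_comp_X_le {α : ℝ≥0 → ℝ} (h : M.IsMixing μ α)
    (hμ : M.IsInvariant μ) {f : E → ℝ} (hf : Measurable f) {K : ℝ} (hK : ∀ x, |f x| ≤ K)
    (hmean : ∫ x, f x ∂μ = 0) (s u : ℝ≥0) :
    |∫ ω, f (M.X s ω) * f (M.X u ω) ∂(M.law μ)| ≤ 4 * α (nndist s u) * K ^ 2 := by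
  wlog hsu : s ≤ u generalizing s u
  · simpa only [mul_comm, nndist_comm] using this u s (le_of_not_ge hsu)
  obtain ⟨l, rfl⟩ := exists_add_of_le hsu
  have hl : nndist s (s + l) = l := by
    rw [NNReal.nndist_eq, add_tsub_cancel_left, tsub_eq_zero_of_le hsu, max_eq_right zero_le]
  rw [hl]
  have hcov := h.abs_integral_mul_comp_X_sub_le hμ s l
    (hf.comp (M.measurable_X_past le_rfl)).aestronglyMeasurable (fun _ => hK _) hf hK
  rwa [hmean, mul_zero, sub_zero, mul_assoc, ← sq] at hcov

theorem measurable_uncurry_comp_X_toNNReal (M : MarkovProcess E Ω) {f : E → ℝ}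
    (hf : Measurable f) :
    Measurable (Function.uncurry fun (s : ℝ) ω => f (M.X s.toNNReal ω)) :=
  hf.comp (M.measurable_X.comp
    ((measurable_real_toNNReal.comp measurable_fst).prodMk measurable_snd))

theorem intervalIntegrable_comp_X_toNNReal (M : MarkovProcess E Ω) {f : E → ℝ}
    (hf : Measurable f) {K : ℝ} (hK : ∀ x, |f x| ≤ K) (a b : ℝ) (ω : Ω) :
    IntervalIntegrable (fun s => f (M.X s.toNNReal ω)) volume a b :=
  intervalIntegrable_const (c := K) |>.mono_fun'
    ((M.measurable_uncurry_comp_X_toNNReal hf).comp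
      measurable_prodMk_right).aestronglyMeasurable (ae_of_all _ fun _ => hK _)

theorem IsMixing.integral_sq_setIntegral_comp_X_le {α : ℝ≥0 → ℝ} (h : M.IsMixing μ α)
    (hμ : M.IsInvariant μ) (hα : ∀ s, 0 ≤ α s) (hαint : Integrable fun s : ℝ => α (Real.nnabs s))
    {f : E → ℝ} (hf : Measurable f) {K : ℝ} (hK : ∀ x, |f x| ≤ K) (hmean : ∫ x, f x ∂μ = 0)
    {a b : ℝ} (ha : 0 ≤ a) (hab : a ≤ b) :
    ∫ ω, (∫ s in Set.Ioc a b, f (M.X s.toNNReal ω)) ^ 2 ∂(M.law μ)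
      ≤ 4 * K ^ 2 * (∫ s, α (Real.nnabs s)) * (b - a) := by
  have hvol : volume.real (Set.Ioc a b) = b - a := Real.volume_real_Ioc_of_le hab
  rw [← hvol, ← measureReal_restrict_apply_univ]
  refine integral_sq_integral_le (M.measurable_uncurry_comp_X_toNNReal hf) (fun _ _ => hK _)
    fun u => ?_
  have hshift : Integrable fun s : ℝ => 4 * K ^ 2 * α (Real.nnabs (s - u.toNNReal)) :=
    (hαint.comp_sub_right _).const_mul _
  have hcov : ∀ s ∈ Set.Ioc a b, ‖∫ ω, f (M.X s.toNNReal ω) * f (M.X u.toNNReal ω) ∂(M.law μ)‖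
      ≤ 4 * K ^ 2 * α (Real.nnabs (s - u.toNNReal)) := fun s hs => by
    have hdist : nndist s.toNNReal u.toNNReal = Real.nnabs (s - u.toNNReal) := by
      ext
      rw [coe_nndist, NNReal.dist_eq, Real.coe_toNNReal s (ha.trans hs.1.le), Real.coe_nnabs]
    rw [Real.norm_eq_abs, mul_right_comm, ← hdist]
    exact h.abs_integral_comp_X_mul_comp_X_le hμ hf hK hmean _ _
  calc ∫ s in Set.Ioc a b, ∫ ω, f (M.X s.toNNReal ω) * f (M.X u.toNNReal ω) ∂(M.law μ)
      ≤ ∫ s in Set.Ioc a b, 4 * K ^ 2 * α (Real.nnabs (s - u.toNNReal)) :=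
        (Real.le_norm_self _).trans <| norm_integral_le_of_norm_le hshift.integrableOn
          (ae_restrict_of_forall_mem measurableSet_Ioc hcov)
    _ ≤ ∫ s, 4 * K ^ 2 * α (Real.nnabs (s - u.toNNReal)) :=
        setIntegral_le_integral hshift
          (ae_of_all _ fun s => mul_nonneg (by positivity) (hα _))
    _ = 4 * K ^ 2 * ∫ s, α (Real.nnabs s) := by
        rw [integral_const_mul, integral_sub_right_eq_self fun s => α (Real.nnabs s)]

/-! ### Block averages -/

/-- The mean value of `f` along the path over the time interval `[i * l, (i + 1) * l]`. -/
noncomputable def blockAverage (M : MarkovProcess E Ω) (f : E → ℝ) (l : ℝ≥0) (i : ℕ) (ω : Ω) : ℝ :=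
  (l : ℝ)⁻¹ * ∫ s in Set.Ioc (i * l : ℝ) ((i + 1) * l), f (M.X s.toNNReal ω)

theorem aestronglyMeasurable_blockAverage {E Ω : Type*} [MeasurableSpace E]
    {m m0 : MeasurableSpace Ω} {M : MarkovProcess E Ω} {μ : Measure E} [IsProbabilityMeasure μ]
    (hm : m ≤ m0) {f : E → ℝ} (hf : Measurable f) {K : ℝ} (hK : ∀ x, |f x| ≤ K) (l : ℝ≥0) (i : ℕ)
    (hX : ∀ s ∈ Set.Icc (i * l) ((i + 1) * l), Measurable[m] (M.X s)) :
    AEStronglyMeasurable[m] (M.blockAverage f l i) (M.law μ) := by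
  refine (aestronglyMeasurable_integral_of_ae hm (M.measurable_uncurry_comp_X_toNNReal hf)
    (fun _ _ => hK _) (ae_restrict_of_forall_mem measurableSet_Ioc fun s hs => ?_)).const_mul _
  have hs0 : 0 ≤ s := (by positivity : (0 : ℝ) ≤ i * l).trans hs.1.le
  refine (hf.comp (hX _ ⟨?_, ?_⟩)).aestronglyMeasurable <;>
    rw [← NNReal.coe_le_coe, Real.coe_toNNReal s hs0] <;> push_cast
  exacts [hs.1.le, hs.2]

theorem aestronglyMeasurable_blockAverage_past {f : E → ℝ} (hf : Measurable f) {K : ℝ}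
    (hK : ∀ x, |f x| ≤ K) (l : ℝ≥0) (i : ℕ) :
    AEStronglyMeasurable[M.past ((i + 1) * l)] (M.blockAverage f l i) (M.law μ) :=
  aestronglyMeasurable_blockAverage (M.past_le _) hf hK l i fun _ hs => M.measurable_X_past hs.2

theorem aestronglyMeasurable_blockAverage_future {f : E → ℝ} (hf : Measurable f) {K : ℝ}
    (hK : ∀ x, |f x| ≤ K) (l : ℝ≥0) (i : ℕ) :
    AEStronglyMeasurable[M.future (i * l)] (M.blockAverage f l i) (M.law μ) :=
  aestronglyMeasurable_blockAverage (M.future_le _) hf hK l i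
    fun _ hs => M.measurable_X_future hs.1

theorem abs_blockAverage_le {f : E → ℝ} {K : ℝ} (hK : ∀ x, |f x| ≤ K) {l : ℝ≥0} (hl : 0 < l)
    (i : ℕ) (ω : Ω) : |M.blockAverage f l i ω| ≤ K := by
  have hl' : (0 : ℝ) < l := hl
  have hvol : volume.real (Set.Ioc (i * l : ℝ) ((i + 1) * l)) = l := by
    rw [Real.volume_real_Ioc_of_le (by nlinarith)]
    ring
  have hint := norm_setIntegral_le_of_norm_le_const (μ := volume) (C := K)
    (f := fun s : ℝ => f (M.X s.toNNReal ω)) (s := Set.Ioc (i * l : ℝ) ((i + 1) * l))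
    measure_Ioc_lt_top fun _ _ => hK _
  rw [hvol] at hint
  rwa [blockAverage, abs_mul, abs_inv, abs_of_pos hl', inv_mul_le_iff₀ hl', mul_comm _ K]

theorem integral_blockAverage_eq_zero (hμ : M.IsInvariant μ) {f : E → ℝ} (hf : Measurable f)
    {K : ℝ} (hK : ∀ x, |f x| ≤ K) (hmean : ∫ x, f x ∂μ = 0) (l : ℝ≥0) (i : ℕ) :
    ∫ ω, M.blockAverage f l i ω ∂(M.law μ) = 0 := by
  have hint : Integrable (Function.uncurry fun ω (s : ℝ) => f (M.X s.toNNReal ω))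
      ((M.law μ).prod (volume.restrict (Set.Ioc (i * l : ℝ) ((i + 1) * l)))) :=
    integrable_of_forall_abs_le
      ((M.measurable_uncurry_comp_X_toNNReal hf).comp measurable_swap).aestronglyMeasurable
      fun _ => hK _
  simp only [blockAverage, integral_const_mul, integral_integral_swap hint,
    M.integral_law_X hμ _ hf, hmean, integral_zero, mul_zero]

theorem IsMixing.integral_sq_blockAverage_le {α : ℝ≥0 → ℝ} (h : M.IsMixing μ α)
    (hμ : M.IsInvariant μ) (hα : ∀ s, 0 ≤ α s) (hαint : Integrable fun s : ℝ => α (Real.nnabs s))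
    {f : E → ℝ} (hf : Measurable f) {K : ℝ} (hK : ∀ x, |f x| ≤ K) (hmean : ∫ x, f x ∂μ = 0)
    {l : ℝ≥0} (hl : 0 < l) (i : ℕ) :
    ∫ ω, M.blockAverage f l i ω ^ 2 ∂(M.law μ) ≤ 4 * K ^ 2 * (∫ s, α (Real.nnabs s)) / l := by
  simp_rw [blockAverage, mul_pow, integral_const_mul]
  calc (l : ℝ)⁻¹ ^ 2 * ∫ ω, (∫ s in Set.Ioc (i * l : ℝ) ((i + 1) * l), f (M.X s.toNNReal ω)) ^ 2
          ∂(M.law μ)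
      ≤ (l : ℝ)⁻¹ ^ 2 * (4 * K ^ 2 * (∫ s, α (Real.nnabs s)) * ((i + 1) * l - i * l)) := by
        gcongr
        exact h.integral_sq_setIntegral_comp_X_le hμ hα hαint hf hK hmean (by positivity)
          (by gcongr; linarith)
    _ = 4 * K ^ 2 * (∫ s, α (Real.nnabs s)) / l := by
        field_simp
        ring

theorem sum_blockAverage {f : E → ℝ} (hf : Measurable f) {K : ℝ} (hK : ∀ x, |f x| ≤ K)
    (l : ℝ≥0) (n : ℕ) (ω : Ω) :
    ∑ i ∈ Finset.range n, M.blockAverage f l i ω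
      = (l : ℝ)⁻¹ * ∫ s in (0 : ℝ)..n * l, f (M.X s.toNNReal ω) := by
  have hsum := intervalIntegral.sum_integral_adjacent_intervals (n := n)
    (a := fun i : ℕ => (i * l : ℝ)) fun i _ =>
      M.intervalIntegrable_comp_X_toNNReal hf hK _ _ ω
  simp only [Nat.cast_zero, zero_mul] at hsum
  rw [← hsum, Finset.mul_sum]
  refine Finset.sum_congr rfl fun i _ => ?_
  rw [blockAverage, intervalIntegral.integral_of_le (by gcongr; simp), Nat.cast_succ]

/-- The information available before the blocks `e`, `2 + e`, `4 + e`, … of length `l`: nothing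
before the first one, and the past of the end of the previous one before each of the others. One
block separates this information from the next block. -/
@[reducible]
def blockFiltration (M : MarkovProcess E Ω) (l : ℝ≥0) (e : ℕ) : ℕ → MeasurableSpace Ω
  | 0 => ⊥
  | k + 1 => M.past (((2 * k + e : ℕ) + 1) * l)

theorem blockFiltration_mono (l : ℝ≥0) (e : ℕ) : Monotone (M.blockFiltration l e) :=
  monotone_nat_of_le_succ fun
    | 0 => bot_le
    | k + 1 => M.past_mono (by gcongr; omega)

theorem IsMixing.isMixingSequence_blockAverage {α : ℝ≥0 → ℝ} (h : M.IsMixing μ α)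
    (hμ : M.IsInvariant μ) (hα : ∀ s, 0 ≤ α s) {f : E → ℝ} (hf : Measurable f) {K : ℝ}
    (hK : ∀ x, |f x| ≤ K) (l : ℝ≥0) (e : ℕ) :
    IsMixingSequence (M.blockFiltration l e) (fun j => M.blockAverage f l (2 * j + e)) (4 * α l)
      (M.law μ) where
  le
    | 0 => bot_le
    | _ + 1 => M.past_le _
  mono := blockFiltration_mono l e
  adapted k := aestronglyMeasurable_blockAverage_past hf hK l (2 * k + e)
  decoupling := by
    rintro (_ | k) F φ L D hF hφ hL hD
    · obtain ⟨ω₀⟩ : Nonempty Ω := (M.law μ).nonempty_of_neZero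
      have hL0 : 0 ≤ L := (abs_nonneg _).trans (hL ω₀)
      have hD0 : 0 ≤ D := (abs_nonneg _).trans (hD ω₀)
      have hαl := hα l
      rw [integral_mul_eq_mul_integral_of_aestronglyMeasurable_bot (P := M.law μ) hF]
      exact le_add_of_nonneg_right (mul_nonneg (mul_nonneg (by positivity) hL0) hD0)
    · have hgap : ((2 * (k + 1) + e : ℕ) : ℝ≥0) * l = ((2 * k + e : ℕ) + 1) * l + l := by
        push_cast
        ring
      have hG : AEStronglyMeasurable[M.future (((2 * k + e : ℕ) + 1) * l + l)]
          (fun ω => φ (M.blockAverage f l (2 * (k + 1) + e) ω)) (M.law μ) :=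
        hgap ▸ aestronglyMeasurable_comp (P := M.law μ) hφ
          (aestronglyMeasurable_blockAverage_future hf hK l (2 * (k + 1) + e))
      linarith [(abs_le.1 (h.abs_integral_mul_sub_le hμ hF hL hG hD)).2]

theorem measureReal_le_integral_le_two_mul (M : MarkovProcess E Ω) {f : E → ℝ}
    (hf : Measurable f) {K : ℝ} (hK : ∀ x, |f x| ≤ K) {l : ℝ≥0} (hl : 0 < l) {N : ℕ} {R b : ℝ}
    (hb : ∀ e, (M.law μ).real
      {ω | N * R ≤ ∑ j ∈ Finset.range N, M.blockAverage f l (2 * j + e) ω} ≤ b) :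
    (M.law μ).real {ω | R * (2 * N * l) ≤ ∫ s in (0 : ℝ)..2 * N * l, f (M.X s.toNNReal ω)}
      ≤ 2 * b := by
  refine (measureReal_mono fun ω hω => ?_).trans <| (measureReal_union_le _ _).trans <|
    (add_le_add (hb 0) (hb 1)).trans_eq (two_mul b).symm
  have hl' : (0 : ℝ) < l := hl
  have hsum := sum_blockAverage (M := M) hf hK l (2 * N) ω
  rw [sum_range_two_mul, ← div_eq_inv_mul, eq_div_iff hl'.ne'] at hsum
  push_cast at hsum
  have hle : 2 * (N * R) ≤ ∑ j ∈ Finset.range N, M.blockAverage f l (2 * j) ω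
      + ∑ j ∈ Finset.range N, M.blockAverage f l (2 * j + 1) ω := by
    refine le_of_mul_le_mul_right ?_ hl'
    rw [hsum]
    linarith [Set.mem_ofPred_eq ▸ hω]
  rcases le_total (N * R) (∑ j ∈ Finset.range N, M.blockAverage f l (2 * j) ω) with h | h
  · exact Or.inl h
  · exact Or.inr (by rw [Set.mem_ofPred_eq]; linarith)

section Deviation

variable {α : ℝ≥0 → ℝ} {f : E → ℝ} {K A : ℝ} {l : ℝ≥0}

theorem IsMixing.measureReal_le_integral_le_exp (h : M.IsMixing μ α) (hμ : M.IsInvariant μ)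
    (hα : ∀ s, 0 ≤ α s) (hαint : Integrable fun s : ℝ => α (Real.nnabs s))
    (hA : ∫ s, α (Real.nnabs s) ≤ A) (hf : Measurable f) (hK : ∀ x, |f x| ≤ K)
    (hmean : ∫ x, f x ∂μ = 0) (hl : 0 < l) {lam : ℝ} (hlam : 0 ≤ lam) (hlamK : lam * K ≤ 1)
    (N : ℕ) (R : ℝ) :
    (M.law μ).real {ω | R * (2 * N * l) ≤ ∫ s in (0 : ℝ)..2 * N * l, f (M.X s.toNNReal ω)}
      ≤ 2 * ((1 + lam ^ 2 * (4 * K ^ 2 * A / l)) ^ N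
        * (Real.exp (-(lam * (N * R))) + N * (4 * α l) * Real.exp (lam * K))) := by
  have hvar (i : ℕ) : ∫ ω, M.blockAverage f l i ω ^ 2 ∂(M.law μ) ≤ 4 * K ^ 2 * A / l :=
    (h.integral_sq_blockAverage_le hμ hα hαint hf hK hmean hl i).trans (by gcongr)
  exact M.measureReal_le_integral_le_two_mul hf hK hl fun e =>
    (h.isMixingSequence_blockAverage hμ hα hf hK l e).measureReal_le_sum_le
      (mul_nonneg zero_le_four (hα l)) (fun j => abs_blockAverage_le hK hl _) hlam hlamK
      (fun j => integral_blockAverage_eq_zero hμ hf hK hmean l _) (fun j => hvar _) N _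

theorem IsMixing.measureReal_le_integral_le_count (h : M.IsMixing μ α) (hμ : M.IsInvariant μ)
    (hα : ∀ s, 0 ≤ α s) (hαint : Integrable fun s : ℝ => α (Real.nnabs s))
    (hA : ∫ s, α (Real.nnabs s) ≤ A) (hf : Measurable f) (hK0 : 0 < K) (hK : ∀ x, |f x| ≤ K)
    (hmean : ∫ x, f x ∂μ = 0) (hl : 0 < l) {lam : ℝ} (hlam : 0 ≤ lam) (N : ℕ) {R : ℝ}
    (hR : 0 < R) :
    (M.law μ).real {ω | R * (2 * N * l) ≤ ∫ s in (0 : ℝ)..2 * N * l, f (M.X s.toNNReal ω)}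
      ≤ 2 * ((1 + Real.exp lam * (4 * K ^ 2 * A / l / (R / 2) ^ 2)) ^ N
        * (Real.exp (-(lam * (N * (R / 2) / K))) + N * (4 * α l))) := by
  have hvar (i : ℕ) : ∫ ω, M.blockAverage f l i ω ^ 2 ∂(M.law μ) ≤ 4 * K ^ 2 * A / l :=
    (h.integral_sq_blockAverage_le hμ hα hαint hf hK hmean hl i).trans (by gcongr)
  have hv0 : 0 ≤ 4 * K ^ 2 * A / l := (integral_nonneg fun _ => sq_nonneg _).trans (hvar 0)
  refine M.measureReal_le_integral_le_two_mul hf hK hl fun e => ?_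
  have hcount : {ω | N * R ≤ ∑ j ∈ Finset.range N, M.blockAverage f l (2 * j + e) ω}
      ⊆ {ω | ⌈N * (R / 2) / K⌉₊ ≤
        {j ∈ Finset.range N | R / 2 ≤ M.blockAverage f l (2 * j + e) ω}.card} := fun ω hω => by
    have hcard := mul_half_le_mul_card_filter_of_le_sum (Finset.range N)
      (fun j => (abs_le.1 (abs_blockAverage_le (M := M) hK hl (2 * j + e) ω)).2) hR.le
      (by rwa [Finset.card_range])
    rw [Finset.card_range] at hcard
    exact Nat.ceil_le.2 ((div_le_iff₀' hK0).2 hcard)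
  refine (measureReal_mono hcount).trans <|
    ((h.isMixingSequence_blockAverage hμ hα hf hK l e).measureReal_le_card_filter_le
      (mul_nonneg zero_le_four (hα l)) (fun j => abs_blockAverage_le hK hl _) hlam (half_pos hR)
      (fun j => hvar _) N _).trans ?_
  gcongr
  exact Nat.le_ceil _

end Deviation

end MarkovProcess

/-! ### Integrals of the mixing rate and estimates in the two regimes -/

theorem Gamma_add_one_le {θ : ℝ} (hθ : 0 < θ) : Real.Gamma (θ + 1) ≤ 2 * θ ^ θ := by
  have hpow (x : ℝ) (hx : 0 < x) : Real.exp (-x) * x ^ (θ + 1 - 1)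
      ≤ θ ^ θ * Real.exp (-(1 / 2) * x) := by
    have hbase : x ≤ θ * Real.exp (x / (2 * θ)) := by
      have hexp := Real.two_mul_le_exp (x := x / (2 * θ))
      have hx' : x = θ * (2 * (x / (2 * θ))) := by field_simp
      exact hx'.trans_le (mul_le_mul_of_nonneg_left hexp hθ.le)
    have hle : x ^ θ ≤ θ ^ θ * Real.exp (x / 2) := by
      refine (Real.rpow_le_rpow hx.le hbase hθ.le).trans_eq ?_
      rw [Real.mul_rpow hθ.le (Real.exp_nonneg _), ← Real.exp_mul]
      congr 2
      field_simp
    rw [add_sub_cancel_right]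
    calc Real.exp (-x) * x ^ θ ≤ Real.exp (-x) * (θ ^ θ * Real.exp (x / 2)) := by gcongr
      _ = θ ^ θ * Real.exp (-(1 / 2) * x) := by
        rw [mul_left_comm, ← Real.exp_add]
        ring_nf
  have hint : IntegrableOn (fun x : ℝ => θ ^ θ * Real.exp (-(1 / 2) * x)) (Set.Ioi 0) :=
    (integrableOn_exp_mul_Ioi (by norm_num) 0).const_mul _
  calc Real.Gamma (θ + 1) = ∫ x in Set.Ioi (0 : ℝ), Real.exp (-x) * x ^ (θ + 1 - 1) :=
        Real.Gamma_eq_integral (by positivity)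
    _ ≤ ∫ x in Set.Ioi (0 : ℝ), θ ^ θ * Real.exp (-(1 / 2) * x) :=
        setIntegral_mono_on (Real.GammaIntegral_convergent (by positivity)) hint measurableSet_Ioi
          hpow
    _ = 2 * θ ^ θ := by
        rw [integral_const_mul, integral_exp_mul_Ioi (by norm_num)]
        norm_num
        ring

theorem integral_exp_neg_mul_abs_rpow {q b : ℝ} (hq : 0 < q) (hb : 0 < b) :
    ∫ s, Real.exp (-b * |s| ^ q) = 2 * (b ^ (-1 / q) * Real.Gamma (1 / q + 1)) := by
  rw [integral_comp_abs (f := fun s => Real.exp (-b * s ^ q)), integral_exp_neg_mul_rpow hq hb]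

theorem integrable_exp_neg_mul_abs_rpow {q b : ℝ} (hq : 0 < q) (hb : 0 < b) :
    Integrable fun s : ℝ => Real.exp (-b * |s| ^ q) :=
  not_imp_comm.1 integral_undef <| by
    rw [integral_exp_neg_mul_abs_rpow hq hb]
    have := Real.Gamma_pos_of_pos (s := 1 / q + 1) (by positivity)
    positivity

theorem integral_exp_neg_mul_abs_rpow_le {θ b : ℝ} (hθ : 0 < θ) (hb : 0 < b) :
    ∫ s, Real.exp (-b * |s| ^ (1 / θ)) ≤ 4 * (θ / b) ^ θ := by
  rw [integral_exp_neg_mul_abs_rpow (by positivity) hb, one_div_one_div, div_div_eq_mul_div,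
    div_one, neg_one_mul, Real.div_rpow hθ.le hb.le, Real.rpow_neg hb.le, div_eq_inv_mul]
  calc 2 * ((b ^ θ)⁻¹ * Real.Gamma (θ + 1)) ≤ 2 * ((b ^ θ)⁻¹ * (2 * θ ^ θ)) := by
        gcongr
        exact Gamma_add_one_le hθ
    _ = 4 * ((b ^ θ)⁻¹ * θ ^ θ) := by ring

theorem one_add_pow_le_exp_mul {x : ℝ} (hx : 0 ≤ x) (N : ℕ) : (1 + x) ^ N ≤ Real.exp (N * x) := by
  rw [Real.exp_nat_mul]
  gcongr
  linarith [Real.add_one_le_exp x]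

theorem two_mul_mul_add_le_exp {C x g a b : ℝ} (hg : g ≤ Real.exp C) (ha : 0 ≤ a) (hb : 0 ≤ b)
    (hax : a ≤ Real.exp (-(2 * x))) (hbx : 4 * Real.exp C * b ≤ Real.exp (-x)) (hx : C + 2 ≤ x) :
    2 * (g * (a + b)) ≤ Real.exp (-x) := by
  have hC : 4 * Real.exp C ≤ Real.exp x := by
    have h4 : (4 : ℝ) ≤ Real.exp 2 := by linarith [Real.two_mul_le_exp (x := 2)]
    calc 4 * Real.exp C ≤ Real.exp 2 * Real.exp C := by gcongr
      _ = Real.exp (C + 2) := by rw [add_comm, Real.exp_add]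
      _ ≤ Real.exp x := by gcongr
  have hax' : 4 * Real.exp C * a ≤ Real.exp (-x) := by
    calc 4 * Real.exp C * a ≤ Real.exp x * Real.exp (-(2 * x)) := by gcongr
      _ = Real.exp (-x) := by rw [← Real.exp_add]; ring_nf
  calc 2 * (g * (a + b)) ≤ 2 * (Real.exp C * (a + b)) := by gcongr
    _ ≤ Real.exp (-x) := by linarith

theorem rpow_le_exp_mul {ρ θ x : ℝ} (hρ : 0 ≤ ρ) (hθ : 0 ≤ θ) (h : ρ ≤ Real.exp x) :
    ρ ^ θ ≤ Real.exp (θ * x) := by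
  rw [mul_comm, Real.exp_mul]
  exact Real.rpow_le_rpow hρ h hθ

theorem mul_exp_neg_le_two_div {x : ℝ} (hx : 0 < x) : x * Real.exp (-x) ≤ 2 / x := by
  rw [Real.exp_neg, ← div_eq_mul_inv, div_le_div_iff₀ (Real.exp_pos x) hx]
  nlinarith [Real.quadratic_le_exp_of_nonneg hx.le]

section Regimes

/- `R` is the deviation, `l` the length of the blocks, `N` their number in each parity class, `τ`
the scale of the mixing rate `c * exp (-(θ * (s / τ) ^ (1 / θ)))`, `m` the number of effectively
independent blocks, and `ρ = R ^ (-1 / θ)`. -/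

variable {c θ τ m R ρ l : ℝ} {N : ℕ}

theorem count_prefactor_le (hc : 0 ≤ c) (hθ : 1 ≤ θ) (hτ : 0 < τ) (hR : 0 < R) (hl : 0 < l)
    (hm : 256 * Real.exp 16 ≤ m) (hlen : l / τ = 2 * m ^ (1 + θ) / (R * (N * R)))
    (hρ : ρ ^ θ = R⁻¹) (hρ0 : 0 ≤ ρ) (hρ16 : ρ ≤ 16) (hN : N * R ≤ m) :
    (1 + Real.exp (16 * θ) * (4 * 2 ^ 2 * (c * (4 * τ)) / l / (R / 2) ^ 2)) ^ N
      ≤ Real.exp (128 * c * (256 * Real.exp 16)) := by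
  set Q := 256 * Real.exp 16 with hQ
  have hQ0 : 0 < Q := by positivity
  have hm0 : 0 < m := hQ0.trans_le hm
  have hQpow : Real.exp (16 * θ) * R⁻¹ ^ 2 ≤ Q ^ θ := by
    rw [hQ, Real.mul_rpow (by norm_num) (Real.exp_nonneg _), ← Real.exp_mul, mul_comm, ← hρ,
      show (256 : ℝ) = 16 ^ 2 by norm_num, Real.rpow_pow_comm hρ0]
    gcongr
  have hratio : m * (Q / m) ^ θ ≤ Q := by
    calc m * (Q / m) ^ θ ≤ m * (Q / m) ^ (1 : ℝ) := by
          gcongr ?_ * ?_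
          exact Real.rpow_le_rpow_of_exponent_ge (by positivity) ((div_le_one hm0).2 hm) hθ
      _ = Q := by rw [Real.rpow_one, mul_div_cancel₀ _ hm0.ne']
  refine (one_add_pow_le_exp_mul (by positivity) N).trans (Real.exp_le_exp.2 ?_)
  calc N * (Real.exp (16 * θ) * (4 * 2 ^ 2 * (c * (4 * τ)) / l / (R / 2) ^ 2))
      = 256 * c * Real.exp (16 * θ) * R⁻¹ ^ 2 * N * (τ / l) := by
        field_simp
        ring
    _ = 128 * c * (Real.exp (16 * θ) * R⁻¹ ^ 2) * (N * R) ^ 2 / m ^ (1 + θ) := by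
        rw [← inv_div, hlen, inv_div]
        field_simp
        ring
    _ ≤ 128 * c * Q ^ θ * m ^ 2 / m ^ (1 + θ) := by gcongr
    _ = 128 * c * (m * (Q / m) ^ θ) := by
        rw [Real.rpow_add hm0, Real.rpow_one, Real.div_rpow hQ0.le hm0.le]
        field_simp
    _ ≤ 128 * c * Q := by gcongr

theorem exp_prefactor_le (hc : 0 ≤ c) (hθ : 1 ≤ θ) (hτ : 0 < τ) (hR : 0 < R) (hl : 0 < l)
    (hm : Real.exp 2 ≤ m) (hlen : l / τ = 2 * m ^ (1 + θ) / (R * (N * R)))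
    (hN : N * R ≤ 5 * θ * m) :
    (1 + (1 / 2) ^ 2 * (4 * 2 ^ 2 * (c * (4 * τ)) / l)) ^ N ≤ Real.exp (200 * c) := by
  have hm0 : 0 < m := (Real.exp_pos 2).trans_le hm
  have hθm : θ ^ 2 ≤ m ^ (θ - 1) := by
    calc θ ^ 2 ≤ Real.exp (θ - 1) ^ 2 := by
          gcongr
          linarith [Real.add_one_le_exp (θ - 1)]
      _ = Real.exp 2 ^ (θ - 1) := by
          rw [← Real.exp_mul, ← Real.exp_nat_mul, Nat.cast_ofNat]
      _ ≤ m ^ (θ - 1) := by gcongr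
  refine (one_add_pow_le_exp_mul (by positivity) N).trans (Real.exp_le_exp.2 ?_)
  calc N * ((1 / 2) ^ 2 * (4 * 2 ^ 2 * (c * (4 * τ)) / l)) = 16 * c * N * (τ / l) := by ring
    _ = 8 * c * (N * R) ^ 2 / m ^ (1 + θ) := by
        rw [← inv_div, hlen, inv_div]
        field_simp
        ring
    _ ≤ 8 * c * (5 * θ * m) ^ 2 / m ^ (1 + θ) := by gcongr
    _ = 200 * c * (θ ^ 2 / m ^ (θ - 1)) := by
        rw [show 1 + θ = (2 : ℕ) + (θ - 1) by push_cast; ring, Real.rpow_add hm0,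
          Real.rpow_natCast]
        field_simp
        ring
    _ ≤ 200 * c * 1 := by
        gcongr
        exact (div_le_one (by positivity)).2 hθm
    _ = 200 * c := mul_one _

theorem add_half_le_mul_rpow_one_div (hθ : 0 < θ) (hR : 0 < R) (hm : 0 < m)
    (hlen : l / τ = 2 * m ^ (1 + θ) / (R * (N * R))) (hρ : ρ ^ θ = R⁻¹) (hρ1 : 1 ≤ ρ)
    (hN0 : 0 < N) (hN : N * R ≤ m) :
    θ * (m * ρ) + m / 2 ≤ θ * (l / τ) ^ (1 / θ) := by
  have htwo : (1 + 1 / (2 * θ)) ^ θ ≤ 2 := by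
    have hhalf : Real.exp (1 / 2) ≤ 2 := by
      have := Real.exp_bound_div_one_sub_of_interval (x := 1 / 2) (by norm_num) (by norm_num)
      norm_num at this ⊢
      exact this
    refine (rpow_le_exp_mul (by positivity) (by positivity)
      (x := 1 / (2 * θ)) (by linarith [Real.add_one_le_exp (1 / (2 * θ))])).trans ?_
    rwa [show θ * (1 / (2 * θ)) = 1 / 2 by field_simp]
  have hroot : m * ρ * (1 + 1 / (2 * θ)) ≤ (l / τ) ^ (1 / θ) := by
    rw [one_div θ, Real.le_rpow_inv_iff_of_pos (by positivity) (by rw [hlen]; positivity)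
      (by positivity)]
    calc (m * ρ * (1 + 1 / (2 * θ))) ^ θ = m ^ θ * R⁻¹ * (1 + 1 / (2 * θ)) ^ θ := by
          rw [Real.mul_rpow (by positivity) (by positivity),
            Real.mul_rpow hm.le (by positivity), hρ]
      _ ≤ m ^ θ * R⁻¹ * 2 := by gcongr
      _ = 2 * m ^ (1 + θ) / (R * m) := by
          rw [Real.rpow_add hm, Real.rpow_one]
          field_simp
      _ ≤ l / τ := by rw [hlen]; gcongr
  calc θ * (m * ρ) + m / 2 ≤ θ * (m * ρ) + m * ρ / 2 := by
        gcongr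
        exact le_mul_of_one_le_right hm.le hρ1
    _ = θ * (m * ρ * (1 + 1 / (2 * θ))) := by field_simp
    _ ≤ θ * (l / τ) ^ (1 / θ) := by gcongr

theorem quarter_le_rpow_one_div (hθ : 1 ≤ θ) (hR : 0 < R) (hm : 0 < m)
    (hlen : l / τ = 2 * m ^ (1 + θ) / (R * (N * R))) (hρ : ρ ^ θ = R⁻¹) (hρ0 : 0 ≤ ρ)
    (hN0 : 0 < N) (hN : N * R ≤ 5 * θ * m) : m * ρ / 4 ≤ (l / τ) ^ (1 / θ) := by
  have hfour : 5 * θ ≤ 2 * 4 ^ θ := by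
    have := one_add_mul_self_le_rpow_one_add (s := 3) (by norm_num) hθ
    norm_num at this
    linarith
  rw [one_div θ, Real.le_rpow_inv_iff_of_pos (by positivity) (by rw [hlen]; positivity)
    (by positivity)]
  calc (m * ρ / 4) ^ θ = 2 * (m ^ θ * R⁻¹) / (2 * 4 ^ θ) := by
        rw [Real.div_rpow (by positivity) (by norm_num), Real.mul_rpow hm.le hρ0, hρ]
        field_simp
    _ ≤ 2 * (m ^ θ * R⁻¹) / (5 * θ) := by gcongr
    _ = 2 * m ^ (1 + θ) / (R * (5 * θ * m)) := by
        rw [Real.rpow_add hm, Real.rpow_one]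
        field_simp
    _ ≤ l / τ := by rw [hlen]; gcongr

theorem count_error_le (hc : 0 ≤ c) (hθ : 1 ≤ θ) (hR : 0 < R) {C : ℝ} (hm : 1 ≤ m)
    (hmC : 128 * c * Real.exp C ≤ m) (hlen : l / τ = 2 * m ^ (1 + θ) / (R * (N * R)))
    (hρ : ρ ^ θ = R⁻¹) (hρ1 : 1 ≤ ρ) (hN0 : 0 < N) (hN : N * R ≤ m) :
    4 * Real.exp C * (N * (4 * (c * Real.exp (-(θ * (l / τ) ^ (1 / θ))))))
      ≤ Real.exp (-(θ * m)) := by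
  have hm0 : 0 < m := one_pos.trans_le hm
  have hNle : N ≤ m * Real.exp (θ * (m * (ρ - 1))) := by
    calc (N : ℝ) = N * R * ρ ^ θ := by rw [hρ]; field_simp
      _ ≤ m * Real.exp (θ * (m * (ρ - 1))) := by
          gcongr
          refine rpow_le_exp_mul (by positivity) (by positivity) ?_
          nlinarith [Real.add_one_le_exp (m * (ρ - 1))]
  calc 4 * Real.exp C * (N * (4 * (c * Real.exp (-(θ * (l / τ) ^ (1 / θ))))))
      ≤ 4 * Real.exp C * (m * Real.exp (θ * (m * (ρ - 1)))
          * (4 * (c * Real.exp (-(θ * (m * ρ) + m / 2))))) := by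
        gcongr
        exact add_half_le_mul_rpow_one_div (by positivity) hR hm0 hlen hρ hρ1 hN0 hN
    _ = 32 * c * Real.exp C * (m / 2 * Real.exp (-(m / 2))) * Real.exp (-(θ * m)) := by
        rw [show -(θ * (m * ρ) + m / 2) = -(θ * (m * (ρ - 1))) + -(m / 2) + -(θ * m) by ring,
          Real.exp_add, Real.exp_add, Real.exp_neg (θ * (m * (ρ - 1)))]
        field_simp
        ring
    _ ≤ 32 * c * Real.exp C * (2 / (m / 2)) * Real.exp (-(θ * m)) := by
        gcongr
        exact mul_exp_neg_le_two_div (by positivity)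
    _ = 128 * c * Real.exp C / m * Real.exp (-(θ * m)) := by ring
    _ ≤ Real.exp (-(θ * m)) :=
        mul_le_of_le_one_left (Real.exp_nonneg _) ((div_le_one hm0).2 hmC)

theorem exp_error_le (hc : 0 ≤ c) (hθ : 1 ≤ θ) (hR : 0 < R) {C : ℝ} (hm : 16 ≤ m)
    (hmC : 128 * c * Real.exp (C + 1) ≤ m) (hlen : l / τ = 2 * m ^ (1 + θ) / (R * (N * R)))
    (hρ : ρ ^ θ = R⁻¹) (hρ16 : 16 ≤ ρ) (hN0 : 0 < N) (hN : N * R ≤ 5 * θ * m) :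
    4 * Real.exp C * (N * (4 * (c * Real.exp (-(θ * (l / τ) ^ (1 / θ))))) * Real.exp 1)
      ≤ Real.exp (-(θ * m)) := by
  have hm0 : 0 < m := by linarith
  have hNle : N ≤ 5 * θ * m * Real.exp (θ * (m * ρ / 16)) := by
    calc (N : ℝ) = N * R * ρ ^ θ := by rw [hρ]; field_simp
      _ ≤ 5 * θ * m * Real.exp (θ * (m * ρ / 16)) := by
          gcongr
          refine rpow_le_exp_mul (by positivity) (by positivity) ?_
          nlinarith [Real.add_one_le_exp (m * ρ / 16)]
  have hdecay : Real.exp (-(3 / 16 * (θ * m) * ρ))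
      ≤ Real.exp (-(2 * (θ * m))) * Real.exp (-(θ * m)) := by
    rw [← Real.exp_add, Real.exp_le_exp]
    have hθm : 0 < θ * m := by positivity
    nlinarith
  calc 4 * Real.exp C * (N * (4 * (c * Real.exp (-(θ * (l / τ) ^ (1 / θ))))) * Real.exp 1)
      ≤ 4 * Real.exp C * (5 * θ * m * Real.exp (θ * (m * ρ / 16))
          * (4 * (c * Real.exp (-(θ * (m * ρ / 4))))) * Real.exp 1) := by
        gcongr
        exact quarter_le_rpow_one_div hθ hR hm0 hlen hρ (by positivity) hN0 hN
    _ = 80 * c * Real.exp (C + 1) * (θ * m * Real.exp (-(3 / 16 * (θ * m) * ρ))) := by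
        rw [show -(θ * (m * ρ / 4)) = -(3 / 16 * (θ * m) * ρ) + -(θ * (m * ρ / 16)) by ring,
          Real.exp_add, Real.exp_add, Real.exp_neg (θ * (m * ρ / 16))]
        field_simp
        ring
    _ ≤ 80 * c * Real.exp (C + 1)
          * (θ * m * (Real.exp (-(2 * (θ * m))) * Real.exp (-(θ * m)))) := by gcongr
    _ = 40 * c * Real.exp (C + 1) * (2 * (θ * m) * Real.exp (-(2 * (θ * m))))
          * Real.exp (-(θ * m)) := by ring
    _ ≤ 40 * c * Real.exp (C + 1) * (2 / (2 * (θ * m))) * Real.exp (-(θ * m)) := by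
        gcongr
        exact mul_exp_neg_le_two_div (by positivity)
    _ = 40 * c * Real.exp (C + 1) / (θ * m) * Real.exp (-(θ * m)) := by field_simp
    _ ≤ Real.exp (-(θ * m)) := by
        refine mul_le_of_le_one_left (Real.exp_nonneg _) ((div_le_one (by positivity)).2 ?_)
        nlinarith [show 0 ≤ c * Real.exp (C + 1) by positivity]

end Regimes

theorem mul_rpow_eq_mul_div_rpow {θ b s : ℝ} (hθ : 0 < θ) (hb : 0 < b) (hs : 0 ≤ s) :
    b * s ^ (1 / θ) = θ * (s / (θ / b) ^ θ) ^ (1 / θ) := by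
  rw [Real.div_rpow hs (by positivity), ← Real.rpow_mul (by positivity),
    mul_one_div_cancel hθ.ne', Real.rpow_one]
  field_simp

theorem exists_nat_between {x y : ℝ} (hx : 0 ≤ x) (h : x + 1 ≤ y) :
    ∃ N : ℕ, x ≤ N ∧ (N : ℝ) ≤ y :=
  ⟨⌈x⌉₊, Nat.le_ceil x, (Nat.ceil_lt_add_one hx).le.trans h⟩

theorem exists_blockLength {θ τ m R t : ℝ} {N : ℕ} (hτ : 0 < τ) (hm : 0 < m) (hR : 0 < R)
    (ht : R ^ 2 * t = 4 * m ^ (1 + θ) * τ) (hN : 0 < N) :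
    ∃ l : ℝ≥0, 0 < l ∧ 2 * N * l = t ∧ l / τ = 2 * m ^ (1 + θ) / (R * (N * R)) := by
  have ht' : t = 4 * m ^ (1 + θ) * τ / R ^ 2 := by
    rw [← ht]
    field_simp
  have hpos : 0 < t / (2 * N) := by
    rw [ht']
    positivity
  refine ⟨(t / (2 * N)).toNNReal, Real.toNNReal_pos.2 hpos, ?_, ?_⟩ <;>
    rw [Real.coe_toNNReal _ hpos.le]
  · field_simp
  · rw [ht']
    field_simp
    ring

/-- The logarithm of a bound for the moment generating functions of all blocks together. -/
noncomputable def prefactorExponent (c : ℝ) : ℝ :=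
  128 * c * (256 * Real.exp 16)

/-- The number `m` of effectively independent blocks from which on the deviation bound
`exp (-θ * m)` holds. -/
noncomputable def deviationThreshold (c : ℝ) : ℝ :=
  256 * Real.exp 16 + (prefactorExponent c + 2) + 128 * c * Real.exp (prefactorExponent c + 1)

theorem le_deviationThreshold {c : ℝ} (hc : 0 ≤ c) :
    256 * Real.exp 16 ≤ deviationThreshold c ∧ prefactorExponent c + 2 ≤ deviationThreshold c ∧
      128 * c * Real.exp (prefactorExponent c + 1) ≤ deviationThreshold c := by
  have hQ : 0 ≤ 256 * Real.exp 16 := by positivity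
  have hC : 0 ≤ prefactorExponent c := by
    unfold prefactorExponent
    positivity
  have hE : 0 ≤ 128 * c * Real.exp (prefactorExponent c + 1) := by positivity
  unfold deviationThreshold
  exact ⟨by linarith, by linarith, by linarith⟩

theorem deviationThreshold_pos {c : ℝ} (hc : 0 ≤ c) : 0 < deviationThreshold c :=
  (by positivity : 0 < 256 * Real.exp 16).trans_le (le_deviationThreshold hc).1

theorem integrable_exp_neg_mul_nnabs_rpow (c : ℝ) {θ b : ℝ} (hθ : 0 < θ) (hb : 0 < b) :
    Integrable fun s : ℝ => c * Real.exp (-b * (Real.nnabs s : ℝ) ^ (1 / θ)) := by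
  simp only [Real.coe_nnabs]
  exact (integrable_exp_neg_mul_abs_rpow (by positivity) hb).const_mul c

theorem integral_exp_neg_mul_nnabs_rpow_le {c θ b : ℝ} (hc : 0 ≤ c) (hθ : 0 < θ) (hb : 0 < b) :
    ∫ s : ℝ, c * Real.exp (-b * (Real.nnabs s : ℝ) ^ (1 / θ)) ≤ c * (4 * (θ / b) ^ θ) := by
  simp only [Real.coe_nnabs, integral_const_mul]
  gcongr
  exact integral_exp_neg_mul_abs_rpow_le hθ hb

namespace MarkovProcess

variable {E Ω : Type*} [MeasurableSpace E] [MeasurableSpace Ω] {M : MarkovProcess E Ω}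
  {μ : Measure E} [IsProbabilityMeasure μ] {c θ b m R ρ t : ℝ} {f : E → ℝ}

theorem IsMixing.measureReal_le_integral_le_of_le_sixteen
    (h : M.IsMixing μ fun s => c * Real.exp (-b * (s : ℝ) ^ (1 / θ))) (hμ : M.IsInvariant μ)
    (hc : 0 ≤ c) (hθ : 1 ≤ θ) (hb : 0 < b) (hf : Measurable f) (hK : ∀ x, |f x| ≤ 2)
    (hmean : ∫ x, f x ∂μ = 0) (hm : deviationThreshold c ≤ m) (hR : 0 < R) (hR1 : R ≤ 1)
    (ht : R ^ 2 * t = 4 * m ^ (1 + θ) * (θ / b) ^ θ) (hρ : ρ ^ θ = R⁻¹) (hρ1 : 1 ≤ ρ)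
    (hρ16 : ρ ≤ 16) :
    (M.law μ).real {ω | R * t ≤ ∫ s in (0 : ℝ)..t, f (M.X s.toNNReal ω)}
      ≤ Real.exp (-(θ * m)) := by
  obtain ⟨hmQ, hmC, hmE⟩ := le_deviationThreshold hc
  have hm16 : 16 ≤ m := by linarith [Real.add_one_le_exp 16]
  have hmR : m ≤ m / R := le_div_self (by positivity) hR hR1
  obtain ⟨N, hNlow, hNup⟩ :=
    exists_nat_between (x := m / R / 2) (y := m / R) (by positivity) (by linarith)
  have hN : 0 < N := Nat.cast_pos.1 ((by positivity : 0 < m / R / 2).trans_le hNlow)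
  rw [div_right_comm, div_le_iff₀ hR] at hNlow
  rw [le_div_iff₀ hR] at hNup
  obtain ⟨l, hl, rfl, hlen⟩ := exists_blockLength (by positivity) (by positivity) hR ht hN
  have hα : c * Real.exp (-b * (l : ℝ) ^ (1 / θ))
      = c * Real.exp (-(θ * (l / (θ / b) ^ θ) ^ (1 / θ))) := by
    rw [neg_mul, mul_rpow_eq_mul_div_rpow (by positivity : 0 < θ) hb l.coe_nonneg]
  refine (h.measureReal_le_integral_le_count hμ (fun s => by positivity)
    (integrable_exp_neg_mul_nnabs_rpow c (by positivity) hb)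
    (integral_exp_neg_mul_nnabs_rpow_le hc (by positivity) hb) hf two_pos hK hmean hl
    (lam := 16 * θ) (by positivity) N hR).trans ?_
  refine two_mul_mul_add_le_exp (C := prefactorExponent c)
    (count_prefactor_le hc hθ (by positivity) hR hl (hmQ.trans hm) hlen hρ (by positivity) hρ16
      hNup) (Real.exp_nonneg _) (by positivity) (Real.exp_le_exp.2 ?_) ?_ ?_
  · nlinarith
  · rw [hα]
    refine count_error_le hc hθ hR (by linarith) ?_ hlen hρ hρ1 hN hNup
    calc 128 * c * Real.exp (prefactorExponent c)
        ≤ 128 * c * Real.exp (prefactorExponent c + 1) := by gcongr; linarith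
      _ ≤ m := hmE.trans hm
  · nlinarith

theorem IsMixing.measureReal_le_integral_le_of_sixteen_le
    (h : M.IsMixing μ fun s => c * Real.exp (-b * (s : ℝ) ^ (1 / θ))) (hμ : M.IsInvariant μ)
    (hc : 0 ≤ c) (hθ : 1 ≤ θ) (hb : 0 < b) (hf : Measurable f) (hK : ∀ x, |f x| ≤ 2)
    (hmean : ∫ x, f x ∂μ = 0) (hm : deviationThreshold c ≤ m) (hR : 0 < R) (hR1 : R ≤ 1)
    (ht : R ^ 2 * t = 4 * m ^ (1 + θ) * (θ / b) ^ θ) (hρ : ρ ^ θ = R⁻¹) (hρ16 : 16 ≤ ρ) :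
    (M.law μ).real {ω | R * t ≤ ∫ s in (0 : ℝ)..t, f (M.X s.toNNReal ω)}
      ≤ Real.exp (-(θ * m)) := by
  obtain ⟨hmQ, hmC, hmE⟩ := le_deviationThreshold hc
  have hexp16 : 17 ≤ Real.exp 16 := by linarith [Real.add_one_le_exp 16]
  have hexp2 : Real.exp 2 ≤ Real.exp 16 := by gcongr; norm_num
  have hm16 : 16 ≤ m := by linarith
  have hθm : m ≤ θ * m := le_mul_of_one_le_left (by positivity) hθ
  have hθmR : θ * m ≤ θ * m / R := le_div_self (by positivity) hR hR1
  obtain ⟨N, hNlow, hNup⟩ :=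
    exists_nat_between (x := 4 * (θ * m / R)) (y := 5 * (θ * m / R)) (by positivity) (by linarith)
  have hN : 0 < N := Nat.cast_pos.1 ((by positivity : 0 < 4 * (θ * m / R)).trans_le hNlow)
  rw [← mul_div_assoc, div_le_iff₀ hR] at hNlow
  rw [← mul_div_assoc, le_div_iff₀ hR, ← mul_assoc] at hNup
  obtain ⟨l, hl, rfl, hlen⟩ := exists_blockLength (by positivity) (by positivity) hR ht hN
  have hα : c * Real.exp (-b * (l : ℝ) ^ (1 / θ))
      = c * Real.exp (-(θ * (l / (θ / b) ^ θ) ^ (1 / θ))) := by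
    rw [neg_mul, mul_rpow_eq_mul_div_rpow (by positivity : 0 < θ) hb l.coe_nonneg]
  have hprefactor : 200 * c ≤ prefactorExponent c := by
    unfold prefactorExponent
    nlinarith
  refine (h.measureReal_le_integral_le_exp hμ (fun s => by positivity)
    (integrable_exp_neg_mul_nnabs_rpow c (by positivity) hb)
    (integral_exp_neg_mul_nnabs_rpow_le hc (by positivity) hb) hf hK hmean hl
    (lam := 1 / 2) (by norm_num) (by norm_num) N R).trans ?_
  refine two_mul_mul_add_le_exp (C := prefactorExponent c)
    ((exp_prefactor_le hc hθ (by positivity) hR hl (by linarith) hlen hNup).trans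
      (Real.exp_le_exp.2 hprefactor)) (Real.exp_nonneg _) (by positivity)
    (Real.exp_le_exp.2 (by linarith)) ?_ (by linarith)
  rw [hα, one_div_mul_cancel two_ne_zero]
  exact exp_error_le hc hθ hR hm16 (hmE.trans hm) hlen hρ hρ16 hN hNup

theorem IsMixing.measureReal_le_integral_le_exp_neg
    (h : M.IsMixing μ fun s => c * Real.exp (-b * (s : ℝ) ^ (1 / θ))) (hμ : M.IsInvariant μ)
    (hc : 0 ≤ c) (hθ : 1 ≤ θ) (hb : 0 < b) (hf : Measurable f) (hK : ∀ x, |f x| ≤ 2)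
    (hmean : ∫ x, f x ∂μ = 0) (hm : deviationThreshold c ≤ m) (hR : 0 < R) (hR1 : R ≤ 1)
    (ht : R ^ 2 * t = 4 * m ^ (1 + θ) * (θ / b) ^ θ) :
    (M.law μ).real {ω | R * t ≤ ∫ s in (0 : ℝ)..t, f (M.X s.toNNReal ω)}
      ≤ Real.exp (-(θ * m)) := by
  have hρ : (R⁻¹ ^ (1 / θ)) ^ θ = R⁻¹ := by
    rw [← Real.rpow_mul (by positivity), one_div_mul_cancel (by positivity), Real.rpow_one]
  have hρ1 : 1 ≤ R⁻¹ ^ (1 / θ) := Real.one_le_rpow (one_le_inv₀ hR |>.2 hR1) (by positivity)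
  obtain hρ16 | hρ16 := le_total (R⁻¹ ^ (1 / θ)) 16
  · exact h.measureReal_le_integral_le_of_le_sixteen hμ hc hθ hb hf hK hmean hm hR hR1 ht hρ hρ1
      hρ16
  · exact h.measureReal_le_integral_le_of_sixteen_le hμ hc hθ hb hf hK hmean hm hR hR1 ht hρ hρ16

theorem IsMixing.measureReal_le_average_sub_integral_le_exp_neg {V : E → ℝ}
    (h : M.IsMixing μ fun s => c * Real.exp (-b * (s : ℝ) ^ (1 / θ))) (hμ : M.IsInvariant μ)
    (hc : 0 ≤ c) (hθ : 1 ≤ θ) (hb : 0 < b) (hV : Measurable V) (hV1 : ∀ x, |V x| ≤ 1)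
    (hm : deviationThreshold c ≤ m) (hR : 0 < R) (hR1 : R ≤ 1) (ht0 : 0 < t)
    (ht : R ^ 2 * t = 4 * m ^ (1 + θ) * (θ / b) ^ θ) :
    (M.law μ).real {ω | R ≤ (1 / t) * (∫ s in (0 : ℝ)..t, V (M.X s.toNNReal ω)) - ∫ x, V x ∂μ}
      ≤ Real.exp (-(θ * m)) := by
  have hVint : Integrable V μ := integrable_of_forall_abs_le hV.aestronglyMeasurable hV1
  set v := ∫ x, V x ∂μ
  have hbound (x : E) : |V x - v| ≤ 2 := by
    linarith [abs_sub (V x) v, hV1 x, abs_integral_le_of_forall_abs_le (P := μ) hV1]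
  have hmean : ∫ x, (V x - v) ∂μ = 0 := by
    rw [integral_sub hVint (integrable_const v), integral_const, probReal_univ, one_smul, sub_self]
  refine (measureReal_mono fun ω hω => ?_).trans (h.measureReal_le_integral_le_exp_neg hμ hc hθ hb
    (hV.sub_const v) hbound hmean hm hR hR1 ht)
  rw [Set.mem_ofPred_eq, intervalIntegral.integral_sub
    (M.intervalIntegrable_comp_X_toNNReal hV hV1 _ _ ω) intervalIntegrable_const,
    intervalIntegral.integral_const, sub_zero, smul_eq_mul]
  calc R * t ≤ ((1 / t) * (∫ s in (0 : ℝ)..t, V (M.X s.toNNReal ω)) - v) * t := by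
        gcongr
        exact hω
    _ = (∫ s in (0 : ℝ)..t, V (M.X s.toNNReal ω)) - t * v := by field_simp

end MarkovProcess

theorem exists_effective_number {p c' y k : ℝ} (hp : 0 < p) (hp2 : p < 2) (hc' : 0 < c')
    (hy : 0 ≤ y) (hk : 0 ≤ k)
    (h : 2 * k ^ (1 / p) * ((2 - p) / (p * c')) ^ ((2 - p) / (2 * p)) ≤ y) :
    ∃ m, k ≤ m ∧
      y ^ 2 = 4 * m ^ (1 + (2 - p) / p) * ((2 - p) / p / c') ^ ((2 - p) / p) ∧
      (2 - p) / p * (1 / 2) ^ p * (p * c' / (2 - p)) ^ ((2 - p) / 2) * y ^ p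
        = (2 - p) / p * m := by
  have h2p : 0 < 2 - p := by linarith
  rw [div_div, ← inv_div (2 - p) (p * c')]
  set u := (2 - p) / (p * c')
  have hu0 : 0 < u := by positivity
  set κ := u ^ ((2 - p) / (2 * p)) with hκ
  have hκ0 : 0 < κ := by positivity
  have hκ2 : κ ^ 2 = u ^ ((2 - p) / p) := by
    rw [hκ, ← Real.rpow_mul_natCast hu0.le]
    congr 1
    push_cast
    field_simp
  have hκp : κ ^ p = u ^ ((2 - p) / 2) := by
    rw [hκ, ← Real.rpow_mul hu0.le]
    congr 1
    field_simp
  refine ⟨(y / 2 / κ) ^ p, ?_, ?_, ?_⟩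
  · calc k = (k ^ (1 / p)) ^ p := by
          rw [← Real.rpow_mul hk, one_div_mul_cancel hp.ne', Real.rpow_one]
      _ ≤ (y / 2 / κ) ^ p := by
          refine Real.rpow_le_rpow (by positivity) ?_ hp.le
          rw [div_div, le_div_iff₀ (by positivity)]
          linarith
  · have hexponent : p * (1 + (2 - p) / p) = (2 : ℕ) := by
      push_cast
      field_simp
      ring
    rw [← hκ2, ← Real.rpow_mul (by positivity), hexponent, Real.rpow_natCast]
    field_simp
    norm_num
  · rw [Real.inv_rpow hu0.le, ← hκp, div_div, Real.div_rpow hy (by positivity),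
      Real.mul_rpow zero_le_two hκ0.le, Real.div_rpow zero_le_one zero_le_two, Real.one_rpow]
    field_simp

theorem mainTheorem7_general (c : ℝ) (hc : 0 < c) :
    ∃ k₀ : ℝ, 0 < k₀ ∧
      ∀ (p c' : ℝ), 0 < p → p ≤ 1 → 0 < c' →
      ∀ (E Ω : Type*) [MeasurableSpace E] [MeasurableSpace Ω] (M : MarkovProcess E Ω)
        (μ : Measure E) [IsProbabilityMeasure μ],
      M.IsInvariant μ →
      M.DecayWithRate μ (fun s => c * Real.exp (-c' * (s : ℝ) ^ (p / (2 - p)))) →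
      ∀ V : E → ℝ, Measurable V → (∀ x, |V x| ≤ 1) →
      ∀ R t : ℝ, R ≤ 1 → 0 < t →
        2 * k₀ ^ (1 / p) * ((2 - p) / (p * c')) ^ ((2 - p) / (2 * p)) ≤ R * √t →
        (M.law μ).real
            {ω | R ≤ (1 / t) * (∫ s in (0 : ℝ)..t, V (M.X s.toNNReal ω)) - ∫ x, V x ∂μ}
          ≤ Real.exp (-((2 - p) / p * (1 / 2) ^ p * (p * c' / (2 - p)) ^ ((2 - p) / 2))
              * (R * √t) ^ p) := by
  have hk := deviationThreshold_pos hc.le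
  refine ⟨deviationThreshold c, hk, ?_⟩
  intro p c' hp hp1 hc' E Ω _ _ M μ _ hμ hdecay V hV hV1 R t hR1 ht hthreshold
  have h2p : 0 < 2 - p := by linarith
  have hRt : 0 < R * √t := lt_of_lt_of_le (by positivity) hthreshold
  have hR : 0 < R := pos_of_mul_pos_left hRt (Real.sqrt_nonneg t)
  obtain ⟨m, hm, hm_sq, hm_exp⟩ :=
    exists_effective_number hp (by linarith) hc' hRt.le hk.le hthreshold
  rw [mul_pow, Real.sq_sqrt ht.le] at hm_sq
  rw [neg_mul, hm_exp]
  have hθ : 1 ≤ (2 - p) / p := by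
    rw [one_le_div hp]
    linarith
  have hmix := hdecay.isMixing hμ fun s => by positivity
  rw [← one_div_div (2 - p) p] at hmix
  exact hmix.measureReal_le_average_sub_integral_le_exp_neg hμ hc.le hθ hc' hV hV1 hm hR hR1 ht
    hm_sq

theorem mainTheorem7 (c : ℝ) (hc : 0 < c) :
    ∃ k₀ : ℝ, 0 < k₀ ∧
      ∀ (p c' : ℝ), 0 < p → p ≤ 1 → 0 < c' →
      ∀ (E Ω : Type*) [TopologicalSpace E] [PolishSpace E] [MeasurableSpace E] [BorelSpace E]
        [MeasurableSpace Ω] (M : MarkovProcess E Ω) (μ : Measure E) [IsProbabilityMeasure μ],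
      M.IsInvariant μ →
      M.DecayWithRate μ (fun s => c * Real.exp (-c' * (s : ℝ) ^ (p / (2 - p)))) →
      ∀ V : E → ℝ, Measurable V → IsLUB (Set.range fun x => |V x|) 1 →
      ∀ R t : ℝ, 0 < R → R ≤ 1 → 0 < t → t * (1 - R) < (⌊t⌋ : ℝ) →
        2 * k₀ ^ (1 / p) * ((2 - p) / (p * c')) ^ ((2 - p) / (2 * p))
          ≤ (R - (1 - (⌊t⌋ : ℝ) / t)) * √t →
        (M.law μ).real
            {ω | R ≤ (1 / t) * (∫ s in (0 : ℝ)..t, V (M.X s.toNNReal ω)) - ∫ x, V x ∂μ}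
          ≤ Real.exp (-((2 - p) / p * (1 / 2) ^ p * (p * c' / (2 - p)) ^ ((2 - p) / 2))
              * ((R - (1 - (⌊t⌋ : ℝ) / t)) * √t) ^ p) := by
  obtain ⟨k₀, hk₀, hdeviation⟩ := mainTheorem7_general c hc
  refine ⟨k₀, hk₀, ?_⟩
  intro p c' hp hp1 hc' E Ω _ _ _ _ _ M μ _ hμ hdecay V hV hV1 R t _ hR1 ht _ hthreshold
  have hfloor : R - (1 - (⌊t⌋ : ℝ) / t) ≤ R :=
    sub_le_self R (sub_nonneg.2 ((div_le_one ht).2 (Int.floor_le t)))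
  refine (measureReal_mono fun ω hω => hfloor.trans hω).trans ?_
  exact hdeviation p c' hp hp1 hc' E Ω M μ hμ hdecay V hV (fun x => hV1.1 ⟨x, rfl⟩) _ t
    (hfloor.trans hR1) ht hthreshold
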